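/- **Setting.** There are $m$ items $X_1,\dots,X_m$. Item $i$ has a cost $c_i\ge 0$ and realizes to a random element of a finite groundset $U$; the realization is seen only when the item is probed. Let $\mathcal D$ be the joint distribution of $(X_1,\dots,X_m)$ on $U^m$. Let $f:2^U\to\mathbb Z_{\ge 0}$ be monotone and submodular, and let $Q:=f(U)$. A set $\mathcal S$ of items *covers* $f$ if $f(\{X_i : i\in \mathcal S\})=Q$. Assume that the set of all items covers $f$ with probability one. In *scenario submodular cover* the joint distribution $\mathcal D$ is arbitrary, and $s$ denotes the number of outcomes in $U^m$ that have non-zero probability under $\mathcal D$; in *stochastic submodular cover* the items are independent. A *fully adaptive solution* is a decision tree that probes items one at a time, where each decision may depend on the realizations seen so far. $\mathrm{OPT}$ is the minimum expected total cost of the probed items over all fully adaptive solutions that cover $f$ with probability one. A *set-based $k$-round solution* specifies in each round $j=1,\dots,k$ a set $\mathcal S_j$ of items, depending only on the realizations seen in rounds $1,\dots,j-1$; all items of $\mathcal S_j$ are probed in parallel, and round $j$ costs $\sum_{i\in \mathcal S_j}c_i$. **Theorem.** There are absolute constants $C,c>0$ such that the following holds for every such instance and every integer $r\ge 1$. 1.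 If the items are independent, there is a set-based $2r$-round solution whose expected cost is at most $C\cdot Q^{1/r}\,\log(\max\{Q,2\})\cdot \mathrm{OPT}$ and which covers $f$ with probability at least $1-e^{-cr}$. 2. For every joint distribution of the items, there is a set-based $4r$-round solution whose expected cost is at most $C\cdot s^{1/r}\,\log(\max\{sQ,2\})\cdot \mathrm{OPT}$ and which covers $f$ with probability at least $1-e^{-cr}$. -/

import Mathlib

namespace SubmodularCover

/-- An instance of the (stochastic or scenario) submodular cover problem.  There is a finite set
`ι` of items; item `i` has cost `cost i` and realizes to a random element of the finite groundset
`U`; `dist` is the joint distribution of all the items on the outcomes `x : ι → U`.  The function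
`f` is monotone, submodular and integer-valued.  Probing all the items covers `f` with probability
one, i.e. a solution exists. -/
structure CoverInstance (ι U : Type*) [Fintype ι] [Fintype U] [DecidableEq U] where
  cost : ι → ℝ
  cost_nonneg : ∀ i, 0 ≤ cost i
  dist : PMF (ι → U)
  f : Finset U → ℕ
  mono : Monotone f
  submodular : ∀ S T : Finset U, f (S ∪ T) + f (S ∩ T) ≤ f S + f T
  feasible : ∀ x ∈ dist.support, f (Finset.univ.image x) = f Finset.univ

/-- A fully adaptive solution: a decision tree that either halts, or probes one item and continues
depending on the realization of that item. -/
inductive AdaptivePolicy (ι U : Type*)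
  | halt : AdaptivePolicy ι U
  | probe (i : ι) (next : U → AdaptivePolicy ι U) : AdaptivePolicy ι U

namespace AdaptivePolicy

variable {ι U : Type*}

/-- The set of items that the policy probes when the outcome of the items is `x`. -/
def probed [DecidableEq ι] : AdaptivePolicy ι U → (ι → U) → Finset ι
  | halt, _ => ∅
  | probe i next, x => insert i ((next (x i)).probed x)

/-- The total cost of the probes that the policy makes when the outcome of the items is `x`. -/
def totalCost (c : ι → ℝ) : AdaptivePolicy ι U → (ι → U) → ℝ
  | halt, _ => 0
  | probe i next, x => c i + (next (x i)).totalCost c x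

end AdaptivePolicy

/-- A solution with `k` rounds in the set-based model.  A round fixes a set `S` of items, which
are probed in parallel; the rest of the solution depends on the realizations of the items of `S`
(and, by nesting, on the realizations seen in all the previous rounds). -/
inductive SetPolicy (ι U : Type*) : ℕ → Type _
  | done : SetPolicy ι U 0
  | round {k : ℕ} (S : Finset ι) (next : (S → U) → SetPolicy ι U k) : SetPolicy ι U (k + 1)

namespace SetPolicy

variable {ι U : Type*}

/-- The set of all items that are probed in some round when the outcome of the items is `x`. -/
def probed [DecidableEq ι] : {k : ℕ} → SetPolicy ι U k → (ι → U) → Finset ι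
  | _, done, _ => ∅
  | _, round S next, x => S ∪ (next (fun i => x i)).probed x

/-- The sum over all rounds of the total cost `c(S)` of the set `S` of items that is probed in
the round, when the outcome of the items is `x`. -/
def totalCost (c : ι → ℝ) : {k : ℕ} → SetPolicy ι U k → (ι → U) → ℝ
  | _, done, _ => 0
  | _, round S next, x => (∑ i ∈ S, c i) + (next (fun i => x i)).totalCost c x

end SetPolicy

namespace CoverInstance

variable {ι U : Type*} [Fintype ι] [DecidableEq ι] [Fintype U] [DecidableEq U]

/-- The maximal value `Q = f(U)`. -/
def Q (I : CoverInstance ι U) : ℕ := I.f Finset.univ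

/-- The items are independent: their joint distribution is a product distribution. -/
def IsIndependent (I : CoverInstance ι U) : Prop :=
  ∃ q : ι → PMF U, ∀ x : ι → U, I.dist x = ∏ i, q i (x i)

/-- The number of scenarios: outcomes of the items that have non-zero probability. -/
noncomputable def numScenarios (I : CoverInstance ι U) : ℕ := I.dist.support.ncard

/-- The expectation of a real-valued function of the random outcome of the items. -/
noncomputable def expect (I : CoverInstance ι U) (g : (ι → U) → ℝ) : ℝ :=
  ∑ x, (I.dist x).toReal * g x

/-- Under outcome `x`, the items in `S` cover `f`: their realizations have the maximal value. -/
def IsCovered (I : CoverInstance ι U) (S : Finset ι) (x : ι → U) : Prop :=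
  I.f (S.image x) = I.Q

/-- The adaptive policy covers `f` with probability one. -/
def AlwaysCovers (I : CoverInstance ι U) (T : AdaptivePolicy ι U) : Prop :=
  ∀ x ∈ I.dist.support, I.IsCovered (T.probed x) x

/-- The optimal expected cost of a fully adaptive solution, which has to cover `f` with
probability one. -/
noncomputable def OPT (I : CoverInstance ι U) : ℝ :=
  sInf {a : ℝ | ∃ T : AdaptivePolicy ι U, I.AlwaysCovers T ∧ a = I.expect (T.totalCost I.cost)}

/-- The expected cost of a set-based solution. -/
noncomputable def setCost (I : CoverInstance ι U) {k : ℕ} (P : SetPolicy ι U k) : ℝ :=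
  I.expect (P.totalCost I.cost)

/-- The probability that a set-based solution covers `f`. -/
noncomputable def coverProb (I : CoverInstance ι U) {k : ℕ} (P : SetPolicy ι U k) : ℝ :=
  (I.dist.toOuterMeasure {x | I.IsCovered (P.probed x) x}).toReal

end CoverInstance

end SubmodularCover

set_option linter.unusedSectionVars false

namespace SubmodularCover

section Rounds

variable {ι U : Type*} [Fintype ι] [DecidableEq ι] [Fintype U] [DecidableEq U]

/-- The outcomes that agree with `y` on the items in `K`. -/
def cell (K : Finset ι) (y : ι → U) : Finset (ι → U) := {x | ∀ i ∈ K, x i = y i}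

theorem mem_cell {K : Finset ι} {x y : ι → U} : x ∈ cell K y ↔ ∀ i ∈ K, x i = y i := by
  simp [cell]

theorem self_mem_cell (K : Finset ι) (x : ι → U) : x ∈ cell K x := by
  simp [cell]

theorem cell_congr {K : Finset ι} {x y : ι → U} (h : ∀ i ∈ K, x i = y i) :
    cell K x = cell K y := by
  ext z
  simp only [mem_cell]
  exact forall₂_congr fun i hi => by rw [h i hi]

theorem cell_subset_cell {K S : Finset ι} (h : K ⊆ S) {x y : ι → U} (hx : x ∈ cell K y) :
    cell S x ⊆ cell K y := by
  intro z hz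
  rw [mem_cell] at *
  exact fun i hi => (hz i (h hi)).trans (hx i hi)

theorem cell_empty (y : ι → U) : cell ∅ y = Finset.univ := by
  simp [cell]

/-- An inequality between sums that holds on every cell of `S` holds on every union of cells. -/
theorem sum_le_sum_of_cell {S : Finset ι} {V : Finset (ι → U)} (hV : ∀ x ∈ V, cell S x ⊆ V)
    {F G : (ι → U) → ℝ} (h : ∀ x ∈ V, ∑ z ∈ cell S x, F z ≤ ∑ z ∈ cell S x, G z) :
    ∑ x ∈ V, F x ≤ ∑ x ∈ V, G x := by
  have hmaps : ∀ x ∈ V, cell S x ∈ V.image (cell S) := fun x hx => Finset.mem_image_of_mem _ hx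
  rw [← Finset.sum_fiberwise_of_maps_to hmaps F, ← Finset.sum_fiberwise_of_maps_to hmaps G]
  refine Finset.sum_le_sum fun Z hZ => ?_
  obtain ⟨x, hx, rfl⟩ := Finset.mem_image.1 hZ
  have : ({z ∈ V | cell S z = cell S x} : Finset (ι → U)) = cell S x := by
    ext z
    rw [Finset.mem_filter]
    constructor
    · rintro ⟨-, hz⟩
      exact hz ▸ self_mem_cell S z
    · intro hz
      exact ⟨hV x hx hz, cell_congr (mem_cell.1 hz)⟩
  rw [this]
  exact h x hx

/-- The solution with `k` rounds that probes nothing. -/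
def SetPolicy.idle : (k : ℕ) → SetPolicy ι U k
  | 0 => .done
  | k + 1 => .round ∅ fun _ => SetPolicy.idle k

theorem SetPolicy.totalCost_idle (c : ι → ℝ) (k : ℕ) (x : ι → U) :
    (SetPolicy.idle k : SetPolicy ι U k).totalCost c x = 0 := by
  induction k with
  | zero => rfl
  | succ k ih => simp [SetPolicy.idle, SetPolicy.totalCost, ih]

/-- Probing `S` first, and then following a family of solutions that depends on `K ∪ S`, where
the realizations of `K` are already known. -/
theorem SetPolicy.exists_round_family {k : ℕ} (K S : Finset ι) (P : (ι → U) → SetPolicy ι U k)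
    (hP : DependsOn P (↑(K ∪ S) : Set ι)) (c : ι → ℝ) :
    ∃ P' : (ι → U) → SetPolicy ι U (k + 1), DependsOn P' (K : Set ι) ∧
      ∀ x, (P' x).totalCost c x = (∑ i ∈ S, c i) + (P x).totalCost c x ∧
        (P' x).probed x = S ∪ (P x).probed x := by
  let merge (x : ι → U) (v : S → U) : ι → U := fun i => if h : i ∈ S then v ⟨i, h⟩ else x i
  have hmerge : ∀ x : ι → U, merge x (fun i => x i) = x := by
    intro x
    funext i
    simp [merge]
  refine ⟨fun x => .round S fun v => P (merge x v), ?_, ?_⟩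
  · intro x y hxy
    refine congrArg (SetPolicy.round S) (funext fun v => hP ?_)
    intro i hi
    by_cases h : i ∈ S
    · simp [merge, h]
    · have : i ∈ K := by simpa [h] using hi
      simpa [merge, h] using hxy i this
  · intro x
    simp [SetPolicy.totalCost, SetPolicy.probed, hmerge]

/-- The measure `R` of what remains to be done, once the realizations of some items are known, is
reducible by a factor `D` at cost rate `α`: within a cell where `R < D * m`, a set of items can be
extended at a cost of at most `α * B` so that the probability that `R ≥ m` drops by a constant
factor, up to twice the probability that the reference cost `τ` exceeds `B`. -/
structure IsReducible (c : ι → ℝ) (p τ : (ι → U) → ℝ) (R : Finset ι → (ι → U) → ℕ) (D α : ℝ) :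
    Prop where
  anti : ∀ {S T : Finset ι} (x : ι → U), S ⊆ T → R T x ≤ R S x
  dependsOn : ∀ K : Finset ι, DependsOn (R K) (K : Set ι)
  exists_extension : ∀ (K : Finset ι) (y : ι → U) (m : ℝ), 0 < m → (R K y : ℝ) < D * m →
    ∀ S : Finset ι, K ⊆ S → ∀ B : ℝ, 0 ≤ B → ∃ S' : Finset ι, S ⊆ S' ∧
      ∑ i ∈ S' \ S, c i ≤ α * B ∧
      ∑ x ∈ cell K y with m ≤ (R S' x : ℝ), p x ≤
        2 * (∑ x ∈ cell K y with B < τ x, p x) +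
          (∑ x ∈ cell K y with m ≤ (R S x : ℝ), p x) / 32

/-- Markov's inequality along a geometric sequence of thresholds. -/
theorem geometric_tail_bound {β t : ℝ} (hβ : 0 ≤ β) (ht : 0 ≤ t) (n : ℕ) :
    ∑ i ∈ Finset.range n, (if β * 8 ^ i < t then β * 8 ^ i else 0) ≤ 2 * t := by
  suffices h : ∑ i ∈ Finset.range n, (if β * 8 ^ i < t then β * 8 ^ i else 0) ≤ β * 8 ^ n / 7 ∧
      ∑ i ∈ Finset.range n, (if β * 8 ^ i < t then β * 8 ^ i else 0) ≤ 2 * t from h.2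
  induction n with
  | zero => simp [ht]; positivity
  | succ n ih =>
    rw [Finset.sum_range_succ]
    have h0 : 0 ≤ β * 8 ^ n := by positivity
    have h1 : β * 8 ^ (n + 1) = 8 * (β * 8 ^ n) := by ring
    rw [h1]
    split_ifs with h <;> constructor <;> linarith [ih.1, ih.2]

theorem IsReducible.exists_chain {c : ι → ℝ} {p τ : (ι → U) → ℝ} {R : Finset ι → (ι → U) → ℕ}
    {D α : ℝ} (h : IsReducible c p τ R D α) (hp : ∀ x, 0 ≤ p x) (hτ : ∀ x, 0 ≤ τ x) (hα : 0 ≤ α)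
    (K : Finset ι) (y : ι → U) {m : ℝ} (hm : 0 < m) (hR : (R K y : ℝ) < D * m) :
    ∃ S : ℕ → Finset ι, S 0 = K ∧ (∀ i, S i ⊆ S (i + 1)) ∧
      (∀ i, ∑ x ∈ cell K y with m ≤ (R (S i) x : ℝ), p x ≤ (∑ x ∈ cell K y, p x) / 8 ^ i) ∧
      ∀ n, ∑ i ∈ Finset.range n, (∑ e ∈ S (i + 1) \ S i, c e) *
        (∑ x ∈ cell K y with m ≤ (R (S i) x : ℝ), p x) ≤
          88 * α * ∑ x ∈ cell K y, p x * τ x := by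
  set w := ∑ x ∈ cell K y, p x with hw
  set E := ∑ x ∈ cell K y, p x * τ x with hE
  have hw0 : 0 ≤ w := Finset.sum_nonneg fun x _ => hp x
  have hE0 : 0 ≤ E := Finset.sum_nonneg fun x _ => mul_nonneg (hp x) (hτ x)
  set β := 4 * (E / w) with hβ
  have hβ0 : 0 ≤ β := by positivity
  have hstep : ∀ (i : ℕ) (S : Finset ι), ∃ S' : Finset ι, K ⊆ S → S ⊆ S' ∧
      ∑ e ∈ S' \ S, c e ≤ α * (β * 8 ^ (i + 1)) ∧
      ∑ x ∈ cell K y with m ≤ (R S' x : ℝ), p x ≤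
        2 * (∑ x ∈ cell K y with β * 8 ^ (i + 1) < τ x, p x) +
          (∑ x ∈ cell K y with m ≤ (R S x : ℝ), p x) / 32 := by
    intro i S
    by_cases hS : K ⊆ S
    · obtain ⟨S', hS'⟩ := h.exists_extension K y m hm hR S hS (β * 8 ^ (i + 1)) (by positivity)
      exact ⟨S', fun _ => hS'⟩
    · exact ⟨S, fun hS' => absurd hS' hS⟩
  choose next hnext using hstep
  let S : ℕ → Finset ι := fun n => Nat.rec K next n
  have hS : ∀ i, S (i + 1) = next i (S i) := fun i => rfl
  have hK : ∀ i, K ⊆ S i := by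
    intro i
    induction i with
    | zero => exact subset_rfl
    | succ i ih => exact ih.trans (hnext i (S i) ih).1
  have hS1 := fun i => (hnext i (S i) (hK i)).1
  have hS2 := fun i => (hnext i (S i) (hK i)).2.1
  have hS3 := fun i => (hnext i (S i) (hK i)).2.2
  simp only [← hS] at hS1 hS2 hS3
  set u : ℕ → ℝ := fun i => ∑ x ∈ cell K y with m ≤ (R (S i) x : ℝ), p x with hu
  set v : ℕ → ℝ := fun i => ∑ x ∈ cell K y with β * 8 ^ i < τ x, p x with hv
  have hS3' : ∀ i, u (i + 1) ≤ 2 * v (i + 1) + u i / 32 := hS3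
  have hu0 : ∀ i, 0 ≤ u i := fun i => Finset.sum_nonneg fun x _ => hp x
  have hv0 : ∀ i, 0 ≤ v i := fun i => Finset.sum_nonneg fun x _ => hp x
  have huw : ∀ i, u i ≤ w := fun i =>
    Finset.sum_le_sum_of_subset_of_nonneg (Finset.filter_subset _ _) fun x _ _ => hp x
  have hvw : ∀ i, v i ≤ w := fun i =>
    Finset.sum_le_sum_of_subset_of_nonneg (Finset.filter_subset _ _) fun x _ _ => hp x
  have hmarkov : ∀ i, β * 8 ^ i * v i ≤ E := by
    intro i
    simp only [hv]
    rw [Finset.mul_sum, Finset.sum_filter]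
    refine Finset.sum_le_sum fun x _ => ?_
    split_ifs with hx
    · rw [mul_comm]
      exact mul_le_mul_of_nonneg_left hx.le (hp x)
    · exact mul_nonneg (hp x) (hτ x)
  have hv8 : ∀ i, v i ≤ w / 8 ^ i / 4 := by
    intro i
    rcases hw0.eq_or_lt with h0 | hwpos
    · simpa [← h0] using hvw i
    rcases hE0.eq_or_lt with h0 | hEpos
    · have : v i = 0 := by
        refine Finset.sum_eq_zero fun x hx => ?_
        rw [Finset.mem_filter] at hx
        have hβ' : β = 0 := by rw [hβ, ← h0]; simp
        have hx2 : 0 < τ x := by simpa [hβ'] using hx.2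
        have := (Finset.sum_eq_zero_iff_of_nonneg fun x _ => mul_nonneg (hp x) (hτ x)).1 h0.symm x
          hx.1
        exact (mul_eq_zero.1 this).resolve_right hx2.ne'
      rw [this]
      positivity
    · have h1 := hmarkov i
      have h2 : β * 8 ^ i * v i = E * (4 * 8 ^ i * v i / w) := by
        rw [hβ]
        ring
      rw [h2] at h1
      have h3 : 4 * 8 ^ i * v i / w ≤ 1 := by
        by_contra hcon
        nlinarith
      rw [div_le_one hwpos] at h3
      rw [div_div, le_div_iff₀ (by positivity)]
      linarith
  have hu8 : ∀ i, u i ≤ w / 8 ^ i := by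
    intro i
    induction i with
    | zero => simpa using huw 0
    | succ i ih =>
      have h1 := hS3' i
      have h2 := hv8 (i + 1)
      have h3 : w / 8 ^ i = 8 * (w / 8 ^ (i + 1)) := by
        field_simp
        ring
      have h4 : 0 ≤ w / 8 ^ (i + 1) := by positivity
      rw [h3] at ih
      linarith
  refine ⟨S, rfl, hS1, hu8, fun n => ?_⟩
  have htail : ∑ i ∈ Finset.range n, β * 8 ^ (i + 1) * v (i + 1) ≤ 2 * E := by
    have h1 : ∀ i, β * 8 ^ i * v i =
        ∑ x ∈ cell K y, p x * (if β * 8 ^ i < τ x then β * 8 ^ i else 0) := by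
      intro i
      simp only [hv]
      rw [Finset.mul_sum, Finset.sum_filter]
      refine Finset.sum_congr rfl fun x _ => ?_
      split_ifs <;> ring
    calc ∑ i ∈ Finset.range n, β * 8 ^ (i + 1) * v (i + 1)
        ≤ ∑ i ∈ Finset.range (n + 1), β * 8 ^ i * v i := by
          rw [Finset.sum_range_succ']
          have : 0 ≤ β * 8 ^ 0 * v 0 := mul_nonneg (by positivity) (hv0 0)
          linarith
      _ = ∑ x ∈ cell K y, p x *
            ∑ i ∈ Finset.range (n + 1), (if β * 8 ^ i < τ x then β * 8 ^ i else 0) := by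
          simp only [h1, Finset.mul_sum]
          exact Finset.sum_comm
      _ ≤ ∑ x ∈ cell K y, p x * (2 * τ x) := Finset.sum_le_sum fun x _ =>
          mul_le_mul_of_nonneg_left (geometric_tail_bound hβ0 (hτ x) _) (hp x)
      _ = 2 * E := by
          rw [hE, Finset.mul_sum]
          exact Finset.sum_congr rfl fun x _ => by ring
  have hsum : ∀ n, ∑ i ∈ Finset.range n, β * 8 ^ i * u i ≤
      4 * E + 2 * (∑ i ∈ Finset.range n, β * 8 ^ (i + 1) * v (i + 1)) +
        (∑ i ∈ Finset.range n, β * 8 ^ i * u i) / 4 := by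
    intro n
    have h0 : β * 8 ^ 0 * u 0 ≤ 4 * E := by
      have : β * w ≤ 4 * E := by
        rcases hw0.eq_or_lt with h0 | hwpos
        · rw [← h0]
          simp [hE0]
        · rw [hβ, mul_assoc, div_mul_cancel₀ _ hwpos.ne']
      calc β * 8 ^ 0 * u 0 = β * u 0 := by ring
        _ ≤ β * w := mul_le_mul_of_nonneg_left (huw 0) hβ0
        _ ≤ 4 * E := this
    have h1 : ∀ n, ∑ i ∈ Finset.range n, β * 8 ^ i * u i ≤
        ∑ i ∈ Finset.range (n + 1), β * 8 ^ i * u i := fun n => by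
      rw [Finset.sum_range_succ]
      have : 0 ≤ β * 8 ^ n * u n := mul_nonneg (by positivity) (hu0 n)
      linarith
    refine (h1 n).trans ?_
    rw [Finset.sum_range_succ']
    have h2 : ∑ i ∈ Finset.range n, β * 8 ^ (i + 1) * u (i + 1) ≤
        ∑ i ∈ Finset.range n, (2 * (β * 8 ^ (i + 1) * v (i + 1)) + β * 8 ^ i * u i / 4) := by
      refine Finset.sum_le_sum fun i _ => ?_
      have := mul_le_mul_of_nonneg_left (hS3' i) (by positivity : 0 ≤ β * 8 ^ (i + 1))
      refine this.trans_eq ?_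
      ring
    rw [Finset.sum_add_distrib, ← Finset.mul_sum, ← Finset.sum_div] at h2
    linarith
  have hbound := hsum n
  calc ∑ i ∈ Finset.range n, (∑ e ∈ S (i + 1) \ S i, c e) * u i
      ≤ ∑ i ∈ Finset.range n, 8 * α * (β * 8 ^ i * u i) := by
        refine Finset.sum_le_sum fun i _ => ?_
        refine (mul_le_mul_of_nonneg_right (hS2 i) (hu0 i)).trans_eq ?_
        ring
    _ = 8 * α * ∑ i ∈ Finset.range n, β * 8 ^ i * u i := by rw [Finset.mul_sum]
    _ ≤ 8 * α * (11 * E) := mul_le_mul_of_nonneg_left (by linarith) (by positivity)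
    _ = 88 * α * E := by ring

end Rounds

section Recursion

variable {ι U : Type*} [Fintype ι] [DecidableEq ι] [Fintype U] [DecidableEq U]

/-- Solutions that follow a chain of sets, and switch to the solutions `P₀` as soon as `R < m`. -/
theorem exists_chain_policy {c : ι → ℝ} {p τ : (ι → U) → ℝ} {R : Finset ι → (ι → U) → ℕ}
    (hp : ∀ x, 0 ≤ p x) (hτ : ∀ x, 0 ≤ τ x)
    (hanti : ∀ {S T : Finset ι} (x : ι → U), S ⊆ T → R T x ≤ R S x)
    (hdep : ∀ K : Finset ι, DependsOn (R K) (K : Set ι))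
    {K : Finset ι} {y : ι → U} {m ρ q : ℝ} (hρ : 0 ≤ ρ) (hq : 0 ≤ q) (S : ℕ → Finset ι)
    (hS0 : S 0 = K) (hS : ∀ i, S i ⊆ S (i + 1))
    (hu : ∀ i, ∑ x ∈ cell K y with m ≤ (R (S i) x : ℝ), p x ≤ (∑ x ∈ cell K y, p x) / 8 ^ i)
    (hlow : ∀ (n : ℕ) (S : Finset ι), ∃ P : (ι → U) → SetPolicy ι U n,
      DependsOn P (S : Set ι) ∧ ∀ y, (R S y : ℝ) < m →
        ∑ x ∈ cell S y, p x * (P x).totalCost c x ≤ ρ * ∑ x ∈ cell S y, p x * τ x ∧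
        ∑ x ∈ cell S y with R (S ∪ (P x).probed x) x ≠ 0, p x ≤
          q * (3 / 8) ^ n * ∑ x ∈ cell S y, p x)
    (hq1 : 1 ≤ 4 * q) (n : ℕ) :
    ∀ i, ∃ P : (ι → U) → SetPolicy ι U n, DependsOn P (S i : Set ι) ∧
      ∑ x ∈ cell K y with m ≤ (R (S i) x : ℝ), p x * (P x).totalCost c x ≤
        ∑ j ∈ Finset.range n, (∑ e ∈ S (i + j + 1) \ S (i + j), c e) *
          (∑ x ∈ cell K y with m ≤ (R (S (i + j)) x : ℝ), p x) +
        ρ * ∑ x ∈ cell K y with m ≤ (R (S i) x : ℝ), p x * τ x ∧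
      ∑ x ∈ cell K y with m ≤ (R (S i) x : ℝ) ∧ R (S i ∪ (P x).probed x) x ≠ 0, p x ≤
        4 * q * (3 / 8) ^ n * ((∑ x ∈ cell K y, p x) / 8 ^ i) := by
  have hmono : Monotone S := monotone_nat_of_le_succ hS
  have hKS : ∀ i, K ⊆ S i := fun i => hS0 ▸ hmono (Nat.zero_le i)
  set w := ∑ x ∈ cell K y, p x with hw
  have hw0 : 0 ≤ w := Finset.sum_nonneg fun x _ => hp x
  set N : ℕ → Finset (ι → U) := fun i => {x ∈ cell K y | m ≤ (R (S i) x : ℝ)} with hN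
  induction n with
  | zero =>
    intro i
    refine ⟨fun _ => .done, fun _ _ _ => rfl, ?_, ?_⟩
    · simpa [SetPolicy.totalCost, ← Finset.mul_sum] using
        mul_nonneg hρ (Finset.sum_nonneg fun x _ => mul_nonneg (hp x) (hτ x))
    · refine (Finset.sum_le_sum_of_subset_of_nonneg (t := N i) (fun x hx => ?_)
        fun x _ _ => hp x).trans ((hu i).trans ?_)
      · rw [Finset.mem_filter] at hx
        exact Finset.mem_filter.2 ⟨hx.1, hx.2.1⟩
      · rw [pow_zero, mul_one]
        exact le_mul_of_one_le_left (by positivity) hq1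
  | succ n ih =>
    intro i
    obtain ⟨P₁, hP₁, hcost₁, hfail₁⟩ := ih (i + 1)
    obtain ⟨P₀, hP₀, hP₀'⟩ := hlow n (S (i + 1))
    let Q : (ι → U) → SetPolicy ι U n := fun x => if m ≤ (R (S (i + 1)) x : ℝ) then P₁ x else P₀ x
    have hQ : DependsOn Q (↑(S i ∪ (S (i + 1) \ S i)) : Set ι) := by
      rw [Finset.union_sdiff_of_subset (hS i)]
      intro x z hxz
      simp only [Q]
      rw [hdep _ hxz, hP₁ hxz, hP₀ hxz]
    obtain ⟨P, hP, hPQ⟩ := SetPolicy.exists_round_family (S i) (S (i + 1) \ S i) Q hQ c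
    set V : Finset (ι → U) := {x ∈ N i | ¬ m ≤ (R (S (i + 1)) x : ℝ)} with hV
    have hsplit : ∀ F : (ι → U) → ℝ, ∑ x ∈ N i, F x = ∑ x ∈ N (i + 1), F x + ∑ x ∈ V, F x := by
      intro F
      rw [← Finset.sum_filter_add_sum_filter_not (N i) (fun x => m ≤ (R (S (i + 1)) x : ℝ))]
      congr 2
      ext x
      simp only [hN, Finset.mem_filter]
      constructor
      · rintro ⟨⟨h1, -⟩, h2⟩
        exact ⟨h1, h2⟩
      · rintro ⟨h1, h2⟩
        exact ⟨⟨h1, h2.trans (by exact_mod_cast hanti x (hS i))⟩, h2⟩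
    have hVcell : ∀ x ∈ V, cell (S (i + 1)) x ⊆ V := by
      intro x hx z hz
      simp only [hV, hN, Finset.mem_filter] at hx ⊢
      have h1 : R (S (i + 1)) z = R (S (i + 1)) x := hdep _ fun e he => mem_cell.1 hz e he
      have h2 : R (S i) z = R (S i) x := hdep _ fun e he => mem_cell.1 hz e (hS i he)
      rw [h1, h2]
      exact ⟨⟨cell_subset_cell (hKS _) hx.1.1 hz, hx.1.2⟩, hx.2⟩
    have hVlow : ∀ x ∈ V, (R (S (i + 1)) x : ℝ) < m := fun x hx =>
      not_le.1 (Finset.mem_filter.1 hx).2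
    have hQN : ∀ x ∈ N (i + 1), Q x = P₁ x := fun x hx => if_pos (Finset.mem_filter.1 hx).2
    have hQV : ∀ x ∈ V, Q x = P₀ x := fun x hx => if_neg (not_le.2 (hVlow x hx))
    have hpV : ∑ x ∈ V, p x ≤ w / 8 ^ i := (Finset.sum_le_sum_of_subset_of_nonneg
      (Finset.filter_subset _ _) fun x _ _ => hp x).trans (hu i)
    refine ⟨P, hP, ?_, ?_⟩
    · have h1 : ∑ x ∈ N i, p x * (P x).totalCost c x =
          (∑ e ∈ S (i + 1) \ S i, c e) * (∑ x ∈ N i, p x) +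
            (∑ x ∈ N (i + 1), p x * (P₁ x).totalCost c x +
              ∑ x ∈ V, p x * (P₀ x).totalCost c x) := by
        rw [Finset.sum_congr (s₁ := N (i + 1)) (g := fun x => p x * (Q x).totalCost c x) rfl
            fun x hx => by rw [hQN x hx],
          Finset.sum_congr (s₁ := V) (g := fun x => p x * (Q x).totalCost c x) rfl
            fun x hx => by rw [hQV x hx],
          ← hsplit, Finset.mul_sum, ← Finset.sum_add_distrib]
        refine Finset.sum_congr rfl fun x _ => ?_
        rw [(hPQ x).1]
        ring
      have h2 : ∑ x ∈ V, p x * (P₀ x).totalCost c x ≤ ∑ x ∈ V, ρ * (p x * τ x) := by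
        refine sum_le_sum_of_cell hVcell fun x hx => ?_
        rw [← Finset.mul_sum]
        exact (hP₀' x (hVlow x hx)).1
      rw [← Finset.mul_sum] at h2
      rw [h1, hsplit fun x => p x * τ x, Finset.sum_range_succ']
      have h3 : ∀ j, i + 1 + j = i + (j + 1) := fun j => by ring
      simp only [h3] at hcost₁
      simp only [add_zero]
      linarith
    · have h1 : ∑ x ∈ cell K y with m ≤ (R (S i) x : ℝ) ∧ R (S i ∪ (P x).probed x) x ≠ 0, p x =
          (∑ x ∈ N (i + 1), if R (S (i + 1) ∪ (P₁ x).probed x) x ≠ 0 then p x else 0) +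
            ∑ x ∈ V, if R (S (i + 1) ∪ (P₀ x).probed x) x ≠ 0 then p x else 0 := by
        rw [Finset.sum_congr (s₁ := N (i + 1))
            (g := fun x => if R (S (i + 1) ∪ (Q x).probed x) x ≠ 0 then p x else 0) rfl
            fun x hx => by rw [hQN x hx],
          Finset.sum_congr (s₁ := V)
            (g := fun x => if R (S (i + 1) ∪ (Q x).probed x) x ≠ 0 then p x else 0) rfl
            fun x hx => by rw [hQV x hx],
          ← hsplit, ← Finset.filter_filter, Finset.sum_filter]
        refine Finset.sum_congr rfl fun x _ => ?_
        rw [(hPQ x).2, ← Finset.union_assoc, Finset.union_sdiff_of_subset (hS i)]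
      have h2 : (∑ x ∈ V, if R (S (i + 1) ∪ (P₀ x).probed x) x ≠ 0 then p x else 0) ≤
          ∑ x ∈ V, q * (3 / 8) ^ n * p x := by
        refine sum_le_sum_of_cell hVcell fun x hx => ?_
        rw [← Finset.mul_sum, ← Finset.sum_filter]
        exact (hP₀' x (hVlow x hx)).2
      rw [← Finset.mul_sum] at h2
      have h3 : q * (3 / 8) ^ n * ∑ x ∈ V, p x ≤ q * (3 / 8) ^ n * (w / 8 ^ i) :=
        mul_le_mul_of_nonneg_left hpV (by positivity)
      rw [← Finset.filter_filter, Finset.sum_filter] at hfail₁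
      have h4 : 4 * q * (3 / 8) ^ n * (w / 8 ^ (i + 1)) + q * (3 / 8) ^ n * (w / 8 ^ i) =
          4 * q * (3 / 8) ^ (n + 1) * (w / 8 ^ i) := by
        rw [pow_succ, pow_succ]
        field_simp
        ring
      linarith

theorem IsReducible.exists_policy {c : ι → ℝ} {p τ : (ι → U) → ℝ} {R : Finset ι → (ι → U) → ℕ}
    {D α : ℝ} (h : IsReducible c p τ R D α) (hp : ∀ x, 0 ≤ p x) (hτ : ∀ x, 0 ≤ τ x) (hα : 0 ≤ α)
    (hD : 1 ≤ D) (l : ℕ) : ∀ (n : ℕ) (K : Finset ι), ∃ P : (ι → U) → SetPolicy ι U n,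
      DependsOn P (K : Set ι) ∧ ∀ y, (R K y : ℝ) < D ^ l →
        ∑ x ∈ cell K y, p x * (P x).totalCost c x ≤
          88 * α * l * ∑ x ∈ cell K y, p x * τ x ∧
        ∑ x ∈ cell K y with R (K ∪ (P x).probed x) x ≠ 0, p x ≤
          4 ^ l * (3 / 8) ^ n * ∑ x ∈ cell K y, p x := by
  have hR : ∀ {K : Finset ι} {x y : ι → U}, x ∈ cell K y → R K x = R K y := fun hx =>
    h.dependsOn _ fun i hi => mem_cell.1 hx i hi
  induction l with
  | zero =>
    intro n K
    refine ⟨fun _ => SetPolicy.idle n, fun _ _ _ => rfl, fun y hy => ⟨?_, ?_⟩⟩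
    · simp [SetPolicy.totalCost_idle]
    · have hempty : ({x ∈ cell K y | R (K ∪ ((SetPolicy.idle n : SetPolicy ι U n)).probed x) x ≠ 0}
          : Finset (ι → U)) = ∅ := by
        refine Finset.filter_eq_empty_iff.2 fun x hx => ?_
        have h1 : R K x = 0 := by
          rw [hR hx]
          rw [pow_zero] at hy
          exact Nat.lt_one_iff.1 (by exact_mod_cast hy)
        have h2 := h.anti x (Finset.subset_union_left (s₁ := K)
          (s₂ := (SetPolicy.idle n : SetPolicy ι U n).probed x))
        simpa [h1] using h2
      rw [hempty, Finset.sum_empty]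
      exact mul_nonneg (by positivity) (Finset.sum_nonneg fun x _ => hp x)
  | succ l ih =>
    intro n K
    have hex : ∀ Z : Finset (ι → U), ∃ P : SetPolicy ι U n, ∀ y, Z = cell K y →
        (R K y : ℝ) < D ^ (l + 1) →
        ∑ x ∈ Z, p x * P.totalCost c x ≤ 88 * α * (l + 1 : ℕ) * ∑ x ∈ Z, p x * τ x ∧
        ∑ x ∈ Z with R (K ∪ P.probed x) x ≠ 0, p x ≤
          4 ^ (l + 1) * (3 / 8) ^ n * ∑ x ∈ Z, p x := by
      intro Z
      by_cases hZ : ∃ y, Z = cell K y ∧ (R K y : ℝ) < D ^ (l + 1)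
      swap
      · exact ⟨SetPolicy.idle n, fun y h1 h2 => absurd ⟨y, h1, h2⟩ hZ⟩
      obtain ⟨y, rfl, hy⟩ := hZ
      have hE0 : 0 ≤ ∑ x ∈ cell K y, p x * τ x :=
        Finset.sum_nonneg fun x _ => mul_nonneg (hp x) (hτ x)
      have hw0 : 0 ≤ ∑ x ∈ cell K y, p x := Finset.sum_nonneg fun x _ => hp x
      have hconst : ∀ P : (ι → U) → SetPolicy ι U n, DependsOn P (K : Set ι) →
          ∀ x ∈ cell K y, P x = P y := fun P hP x hx => hP fun i hi => mem_cell.1 hx i hi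
      by_cases hlow : (R K y : ℝ) < D ^ l
      · obtain ⟨P, hP, hPy⟩ := ih n K
        obtain ⟨h1, h2⟩ := hPy y hlow
        refine ⟨P y, fun _ _ _ => ⟨?_, ?_⟩⟩
        · rw [Finset.sum_congr rfl fun x hx => by rw [hconst P hP x hx]] at h1
          refine h1.trans ?_
          push_cast
          nlinarith [mul_nonneg hα hE0]
        · rw [Finset.filter_congr fun x hx => by rw [hconst P hP x hx]] at h2
          refine h2.trans (mul_le_mul_of_nonneg_right ?_ hw0)
          exact mul_le_mul_of_nonneg_right
            (pow_le_pow_right₀ (by norm_num) (Nat.le_succ l)) (by positivity)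
      · have hDl : 0 < D ^ l := by positivity
        have hns : ∀ x ∈ cell K y, D ^ l ≤ (R K x : ℝ) := fun x hx => by
          rw [hR hx]
          exact not_lt.1 hlow
        obtain ⟨S, hS0, hS, hu, hc⟩ := h.exists_chain hp hτ hα K y hDl
          (by rwa [← pow_succ'])
        have hq1 : (1 : ℝ) ≤ 4 * 4 ^ l := by
          have : (1 : ℝ) ≤ 4 ^ l := one_le_pow₀ (by norm_num)
          linarith
        obtain ⟨P, hP, h1, h2⟩ := exists_chain_policy hp hτ h.anti h.dependsOn (by positivity)
          (by positivity) S hS0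
          hS hu ih hq1 n 0
        have hf1 : ({x ∈ cell K y | D ^ l ≤ (R K x : ℝ)} : Finset (ι → U)) = cell K y :=
          Finset.filter_true_of_mem hns
        rw [hS0] at hP
        refine ⟨P y, fun _ _ _ => ⟨?_, ?_⟩⟩
        · rw [hS0, hf1, Finset.sum_congr rfl fun x hx => by rw [hconst P hP x hx]] at h1
          refine h1.trans ?_
          simp only [zero_add]
          have := hc n
          push_cast
          linarith
        · have hf2 : ({x ∈ cell K y | D ^ l ≤ (R (S 0) x : ℝ) ∧
              R (S 0 ∪ (P x).probed x) x ≠ 0} : Finset (ι → U)) =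
              ({x ∈ cell K y | R (K ∪ (P y).probed x) x ≠ 0} : Finset (ι → U)) := by
            refine Finset.filter_congr fun x hx => ?_
            rw [hS0, hconst P hP x hx]
            exact and_iff_right (hns x hx)
          rw [hf2] at h2
          refine h2.trans_eq ?_
          ring
    choose P hP using hex
    refine ⟨fun y => P (cell K y), fun x y hxy => congrArg P (cell_congr hxy), fun y hy => ?_⟩
    obtain ⟨h1, h2⟩ := hP (cell K y) y rfl hy
    have hcell : ∀ x ∈ cell K y, cell K x = cell K y := fun x hx => cell_congr (mem_cell.1 hx)
    constructor
    · rwa [Finset.sum_congr rfl fun x hx => by beta_reduce; rw [hcell x hx]]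
    · rwa [Finset.filter_congr fun x hx => by beta_reduce; rw [hcell x hx]]

end Recursion

theorem sum_biUnion_le_sum {α β : Type*} [DecidableEq β] {g : β → ℝ} (hg : ∀ b, 0 ≤ g b)
    (s : Finset α) (t : α → Finset β) :
    ∑ b ∈ s.biUnion t, g b ≤ ∑ a ∈ s, ∑ b ∈ t a, g b := by
  classical
  induction s using Finset.induction_on with
  | empty => simp
  | insert a s ha ih =>
    rw [Finset.biUnion_insert, Finset.sum_insert ha]
    have h1 := Finset.sum_union_inter (s₁ := t a) (s₂ := s.biUnion t) (f := g)
    have h2 : 0 ≤ ∑ b ∈ t a ∩ s.biUnion t, g b := Finset.sum_nonneg fun b _ => hg b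
    linarith

namespace AdaptivePolicy

variable {ι U : Type*} [DecidableEq ι] [DecidableEq U] {c : ι → ℝ}

/-- The items that the policy probes under outcome `x` until its budget `B` is exhausted. -/
noncomputable def probedWithin (c : ι → ℝ) : AdaptivePolicy ι U → ℝ → (ι → U) → Finset ι
  | halt, _, _ => ∅
  | probe i next, B, x =>
    if c i ≤ B then insert i ((next (x i)).probedWithin c (B - c i) x) else ∅

theorem totalCost_nonneg (hc : ∀ i, 0 ≤ c i) (T : AdaptivePolicy ι U) (x : ι → U) :
    0 ≤ T.totalCost c x := by
  induction T with
  | halt => exact le_rfl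
  | probe i next ih => exact add_nonneg (hc i) (ih _)

theorem sum_probedWithin_le (hc : ∀ i, 0 ≤ c i) (T : AdaptivePolicy ι U) (x : ι → U) :
    ∀ B : ℝ, 0 ≤ B → ∑ i ∈ T.probedWithin c B x, c i ≤ B := by
  induction T with
  | halt => intro B hB; simpa [probedWithin] using hB
  | probe i next ih =>
    intro B hB
    rw [probedWithin]
    split_ifs with h
    · have h1 := ih (x i) (B - c i) (by linarith)
      by_cases hi : i ∈ (next (x i)).probedWithin c (B - c i) x
      · rw [Finset.insert_eq_of_mem hi]
        linarith [hc i]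
      · rw [Finset.sum_insert hi]
        linarith
    · simpa using hB

theorem probedWithin_eq_probed (hc : ∀ i, 0 ≤ c i) (T : AdaptivePolicy ι U) (x : ι → U) :
    ∀ B : ℝ, T.totalCost c x ≤ B → T.probedWithin c B x = T.probed x := by
  induction T with
  | halt => intro B _; rfl
  | probe i next ih =>
    intro B hB
    rw [totalCost] at hB
    rw [probedWithin, probed, if_pos (by linarith [totalCost_nonneg hc (next (x i)) x]),
      ih (x i) (B - c i) (by linarith)]

theorem probedWithin_congr (T : AdaptivePolicy ι U) {x z : ι → U} :
    ∀ B : ℝ, (∀ i ∈ T.probedWithin c B x, z i = x i) →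
      T.probedWithin c B z = T.probedWithin c B x := by
  induction T with
  | halt => intro B _; rfl
  | probe i next ih =>
    intro B h
    rw [probedWithin] at h
    rw [probedWithin, probedWithin]
    split_ifs with hB
    · rw [if_pos hB] at h
      rw [h i (Finset.mem_insert_self _ _),
        ih (x i) (B - c i) fun j hj => h j (Finset.mem_insert_of_mem hj)]
    · rfl

theorem mem_probedWithin_update (T : AdaptivePolicy ι U) (x : ι → U) (e : ι) (u : U) :
    ∀ B : ℝ, e ∈ T.probedWithin c B (Function.update x e u) ↔ e ∈ T.probedWithin c B x := by
  induction T with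
  | halt => intro B; simp [probedWithin]
  | probe i next ih =>
    intro B
    rw [probedWithin, probedWithin]
    split_ifs with hB
    · by_cases hi : e = i
      · simp [hi]
      · rw [Finset.mem_insert, Finset.mem_insert, Function.update_of_ne (Ne.symm hi),
          ih (x i) (B - c i)]
    · rfl

end AdaptivePolicy

namespace CoverInstance

variable {ι U : Type*} [Fintype ι] [DecidableEq ι] [Fintype U] [DecidableEq U]

/-- The probability of an outcome, as a real number. -/
noncomputable def weight (I : CoverInstance ι U) (x : ι → U) : ℝ := (I.dist x).toReal

theorem weight_nonneg (I : CoverInstance ι U) (x : ι → U) : 0 ≤ I.weight x :=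
  ENNReal.toReal_nonneg

theorem weight_ne_zero_iff (I : CoverInstance ι U) (x : ι → U) :
    I.weight x ≠ 0 ↔ x ∈ I.dist.support := by
  rw [weight, PMF.mem_support_iff, ENNReal.toReal_ne_zero]
  exact and_iff_left (I.dist.apply_ne_top x)

theorem isCovered_mono (I : CoverInstance ι U) {S T : Finset ι} (h : S ⊆ T) {x : ι → U}
    (hS : I.IsCovered S x) : I.IsCovered T x :=
  le_antisymm (I.mono (Finset.subset_univ _)) (hS.symm.le.trans (I.mono (Finset.image_subset_image h)))

theorem image_congr {K : Finset ι} {x y : ι → U} (h : ∀ i ∈ (K : Set ι), x i = y i) :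
    K.image x = K.image y :=
  Finset.image_congr h

/-- The scenarios that agree with `x` on `S`. -/
noncomputable def compatible (I : CoverInstance ι U) (S : Finset ι) (x : ι → U) :
    Finset (ι → U) :=
  {z ∈ cell S x | I.weight z ≠ 0}

open Classical in
/-- The number of scenarios that agree with `x` on `S`, or zero if `S` covers `f`. -/
noncomputable def uncertainty (I : CoverInstance ι U) (S : Finset ι) (x : ι → U) : ℕ :=
  if I.IsCovered S x then 0 else (I.compatible S x).card

theorem uncertainty_anti (I : CoverInstance ι U) {S T : Finset ι} (x : ι → U) (h : S ⊆ T) :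
    I.uncertainty T x ≤ I.uncertainty S x := by
  unfold uncertainty
  by_cases hS : I.IsCovered S x
  · rw [if_pos hS, if_pos (I.isCovered_mono h hS)]
  · rw [if_neg hS]
    split_ifs
    · exact Nat.zero_le _
    · exact Finset.card_le_card (Finset.filter_subset_filter _
        (cell_subset_cell h (self_mem_cell S x)))

theorem uncertainty_dependsOn (I : CoverInstance ι U) (K : Finset ι) :
    DependsOn (I.uncertainty K) (K : Set ι) := by
  intro x y h
  unfold uncertainty compatible IsCovered
  rw [image_congr h, cell_congr h]

theorem exists_majority (Z : Finset (ι → U)) (y : ι → U) :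
    ∃ b : ι → U, ∀ (e : ι) (u : U), u ≠ b e → 2 * ({z ∈ Z | z e = u}).card ≤ Z.card := by
  have h : ∀ e : ι, ∃ v : U, ∀ u, u ≠ v → 2 * ({z ∈ Z | z e = u}).card ≤ Z.card := by
    intro e
    obtain ⟨v, -, hv⟩ := Finset.exists_max_image (Finset.univ : Finset U)
      (fun u => (Z.filter fun z => z e = u).card) ⟨y e, Finset.mem_univ _⟩
    refine ⟨v, fun u huv => ?_⟩
    have h1 := hv u (Finset.mem_univ _)
    have h2 : Disjoint ({z ∈ Z | z e = u}) ({z ∈ Z | z e = v}) := by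
      refine Finset.disjoint_filter.2 fun z _ h3 h4 => huv (h3.symm.trans h4)
    have h3 := Finset.card_le_card (Finset.union_subset (Finset.filter_subset (fun z => z e = u) Z)
      (Finset.filter_subset (fun z => z e = v) Z))
    rw [Finset.card_union_of_disjoint h2] at h3
    omega
  choose b hb using h
  exact ⟨b, hb⟩

/-- The cells of `S` inside the cell of `K` that leave a lot of uncertainty are few. -/
theorem card_live_cells_le (I : CoverInstance ι U) {K S : Finset ι} (hKS : K ⊆ S) (y : ι → U)
    {D m : ℝ} (hD : 0 ≤ D) (hm : 0 < m) (hR : (I.uncertainty K y : ℝ) < D * m) :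
    ((({x ∈ cell K y | m ≤ (I.uncertainty S x : ℝ)} : Finset (ι → U)).image (cell S)).card : ℝ)
      ≤ D := by
  set L : Finset (ι → U) := {x ∈ cell K y | m ≤ (I.uncertainty S x : ℝ)} with hL
  rcases L.eq_empty_or_nonempty with h0 | ⟨x₀, hx₀⟩
  · simpa [h0] using hD
  have hlive : ∀ x ∈ L, m ≤ ((I.compatible S x).card : ℝ) := by
    intro x hx
    refine (Finset.mem_filter.1 hx).2.trans ?_
    unfold uncertainty
    split_ifs <;> simp
  have hK : I.uncertainty K y = (I.compatible K y).card := by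
    rw [hL, Finset.mem_filter] at hx₀
    have h1 : I.uncertainty K x₀ = I.uncertainty K y :=
      I.uncertainty_dependsOn K fun i hi => mem_cell.1 hx₀.1 i hi
    have h2 := I.uncertainty_anti x₀ hKS
    have h3 : 0 < I.uncertainty S x₀ := by exact_mod_cast hm.trans_le hx₀.2
    have h4 : I.uncertainty K y ≠ 0 := by omega
    unfold uncertainty at h4 ⊢
    split_ifs at h4 ⊢ with h5
    · exact absurd rfl h4
    · rfl
  have hcard : ∑ Z ∈ L.image (cell S), ({z ∈ Z | I.weight z ≠ 0} : Finset (ι → U)).card ≤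
      (I.compatible K y).card := by
    rw [← Finset.card_biUnion]
    · refine Finset.card_le_card fun z hz => ?_
      simp only [Finset.mem_biUnion, Finset.mem_image, Finset.mem_filter] at hz
      obtain ⟨_, ⟨x, hx, rfl⟩, hz, hz'⟩ := hz
      exact Finset.mem_filter.2 ⟨cell_subset_cell hKS (Finset.mem_filter.1 hx).1 hz, hz'⟩
    · intro Z hZ Z' hZ' hne
      obtain ⟨x, -, rfl⟩ := Finset.mem_image.1 hZ
      obtain ⟨x', -, rfl⟩ := Finset.mem_image.1 hZ'
      refine Finset.disjoint_left.2 fun z hz hz' => hne ?_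
      rw [← cell_congr (mem_cell.1 (Finset.mem_filter.1 hz).1),
        ← cell_congr (mem_cell.1 (Finset.mem_filter.1 hz').1)]
  have h1 : ((L.image (cell S)).card : ℝ) * m ≤ ((I.compatible K y).card : ℝ) := by
    rw [← nsmul_eq_mul, ← Finset.sum_const]
    refine le_trans (Finset.sum_le_sum (g := fun Z =>
      (({z ∈ Z | I.weight z ≠ 0} : Finset (ι → U)).card : ℝ)) fun Z hZ => ?_)
      (by exact_mod_cast hcard)
    obtain ⟨x, hx, rfl⟩ := Finset.mem_image.1 hZ
    exact hlive x hx
  rw [hK] at hR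
  exact le_of_mul_le_mul_right (h1.trans hR.le) hm

theorem exists_halving (I : CoverInstance ι U) {T : AdaptivePolicy ι U} (hT : I.AlwaysCovers T)
    {K S : Finset ι} (hKS : K ⊆ S) (y : ι → U) {D m B : ℝ} (hD : 0 ≤ D) (hm : 0 < m) (hB : 0 ≤ B)
    (hR : (I.uncertainty K y : ℝ) < D * m) :
    ∃ S' : Finset ι, S ⊆ S' ∧ ∑ i ∈ S' \ S, I.cost i ≤ D * B ∧
      ∀ x ∈ cell K y, I.weight x ≠ 0 → T.totalCost I.cost x ≤ B → m ≤ (I.uncertainty S' x : ℝ) →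
        2 * I.uncertainty S' x ≤ I.uncertainty S x := by
  choose b hb using fun Z : Finset (ι → U) => exists_majority {z ∈ Z | I.weight z ≠ 0} y
  set L : Finset (ι → U) := {x ∈ cell K y | m ≤ (I.uncertainty S x : ℝ)} with hL
  let A : Finset ι := (L.image (cell S)).biUnion fun Z => T.probedWithin I.cost B (b Z)
  refine ⟨S ∪ A, Finset.subset_union_left, ?_, ?_⟩
  · calc ∑ i ∈ (S ∪ A) \ S, I.cost i ≤ ∑ i ∈ A, I.cost i := by
          refine Finset.sum_le_sum_of_subset_of_nonneg ?_ fun i _ _ => I.cost_nonneg i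
          rw [Finset.union_sdiff_left]
          exact Finset.sdiff_subset
      _ ≤ ∑ Z ∈ L.image (cell S), ∑ i ∈ T.probedWithin I.cost B (b Z), I.cost i :=
          sum_biUnion_le_sum I.cost_nonneg _ _
      _ ≤ ∑ Z ∈ L.image (cell S), B := Finset.sum_le_sum fun Z _ =>
          AdaptivePolicy.sum_probedWithin_le I.cost_nonneg T _ B hB
      _ = ((L.image (cell S)).card : ℝ) * B := by rw [Finset.sum_const, nsmul_eq_mul]
      _ ≤ D * B := mul_le_mul_of_nonneg_right (I.card_live_cells_le hKS y hD hm hR) hB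
  · intro x hx hpx hτ hlive
    have hpos : I.uncertainty (S ∪ A) x ≠ 0 := by
      have : 0 < I.uncertainty (S ∪ A) x := by exact_mod_cast hm.trans_le hlive
      omega
    have hSA : I.uncertainty (S ∪ A) x ≤ I.uncertainty S x :=
      I.uncertainty_anti x Finset.subset_union_left
    have hncov : ¬ I.IsCovered (S ∪ A) x := fun h => hpos (if_pos h)
    have hncov' : ¬ I.IsCovered S x := fun h =>
      hncov (I.isCovered_mono Finset.subset_union_left h)
    have hxL : x ∈ L := Finset.mem_filter.2 ⟨hx, hlive.trans (by exact_mod_cast hSA)⟩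
    have hA : T.probedWithin I.cost B (b (cell S x)) ⊆ A :=
      Finset.subset_biUnion_of_mem (fun Z => T.probedWithin I.cost B (b Z))
        (Finset.mem_image_of_mem _ hxL)
    have hdev : ∃ e ∈ T.probedWithin I.cost B (b (cell S x)), x e ≠ b (cell S x) e := by
      by_contra! hcon
      have h1 := AdaptivePolicy.probedWithin_congr T B hcon
      rw [AdaptivePolicy.probedWithin_eq_probed I.cost_nonneg T x B hτ] at h1
      exact hncov (I.isCovered_mono ((h1.le.trans hA).trans Finset.subset_union_right)
        (hT x ((I.weight_ne_zero_iff x).1 hpx)))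
    obtain ⟨e, he, hne⟩ := hdev
    have h1 := hb (cell S x) e (x e) hne
    rw [uncertainty, uncertainty, if_neg hncov, if_neg hncov']
    refine le_trans (Nat.mul_le_mul_left 2 (Finset.card_le_card ?_)) h1
    intro z hz
    obtain ⟨hz1, hz2⟩ := Finset.mem_filter.1 hz
    refine Finset.mem_filter.2 ⟨Finset.mem_filter.2
      ⟨cell_subset_cell Finset.subset_union_left (self_mem_cell S x) hz1, hz2⟩, ?_⟩
    exact mem_cell.1 hz1 e (Finset.mem_union_right _ (hA he))

theorem isReducible_uncertainty (I : CoverInstance ι U) {T : AdaptivePolicy ι U}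
    (hT : I.AlwaysCovers T) {D : ℝ} (hD : 0 ≤ D) {t : ℕ} (ht : D ≤ 2 ^ t) :
    IsReducible I.cost I.weight (T.totalCost I.cost) I.uncertainty D (D * t) := by
  refine ⟨I.uncertainty_anti, I.uncertainty_dependsOn, ?_⟩
  intro K y m hm hR S hKS B hB
  have key : ∀ t : ℕ, ∃ S' : Finset ι, S ⊆ S' ∧ ∑ i ∈ S' \ S, I.cost i ≤ D * t * B ∧
      ∀ x ∈ cell K y, I.weight x ≠ 0 → T.totalCost I.cost x ≤ B → m ≤ (I.uncertainty S' x : ℝ) →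
        2 ^ t * I.uncertainty S' x ≤ I.uncertainty S x := by
    intro t
    induction t with
    | zero => exact ⟨S, subset_rfl, by simp, by simp⟩
    | succ t ih =>
      obtain ⟨S₁, hS₁, hc₁, hl₁⟩ := ih
      obtain ⟨S₂, hS₂, hc₂, hl₂⟩ := I.exists_halving hT (hKS.trans hS₁) y hD hm hB hR
      refine ⟨S₂, hS₁.trans hS₂, ?_, fun x hx hpx hτ hlive => ?_⟩
      · have h1 : S₂ \ S ⊆ (S₂ \ S₁) ∪ (S₁ \ S) := by
          intro i
          simp only [Finset.mem_union, Finset.mem_sdiff]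
          tauto
        have h2 := Finset.sum_le_sum_of_subset_of_nonneg h1 fun i _ _ => I.cost_nonneg i
        rw [Finset.sum_union (Finset.disjoint_left.2 fun i h h' =>
          (Finset.mem_sdiff.1 h).2 (Finset.mem_sdiff.1 h').1)] at h2
        push_cast
        linarith
      · have h1 := hl₂ x hx hpx hτ hlive
        have h2 := hl₁ x hx hpx hτ (hlive.trans (by exact_mod_cast I.uncertainty_anti x hS₂))
        calc 2 ^ (t + 1) * I.uncertainty S₂ x = 2 ^ t * (2 * I.uncertainty S₂ x) := by ring
          _ ≤ 2 ^ t * I.uncertainty S₁ x := Nat.mul_le_mul_left _ h1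
          _ ≤ _ := h2
  obtain ⟨S', hS', hc, hl⟩ := key t
  refine ⟨S', hS', hc, ?_⟩
  have hp := I.weight_nonneg
  have h1 : ∑ x ∈ cell K y with m ≤ (I.uncertainty S' x : ℝ), I.weight x ≤
      ∑ x ∈ cell K y with B < T.totalCost I.cost x, I.weight x := by
    rw [Finset.sum_filter, Finset.sum_filter]
    refine Finset.sum_le_sum fun x hx => ?_
    by_cases hτ : B < T.totalCost I.cost x
    · rw [if_pos hτ]
      split_ifs
      exacts [le_rfl, hp x]
    · rw [if_neg hτ]
      split_ifs with hlive
      swap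
      · exact le_rfl
      by_contra hpx
      have h2 := hl x hx (fun h0 => hpx h0.le) (not_lt.1 hτ) hlive
      have h3 : I.uncertainty S x ≤ I.uncertainty K y :=
        (I.uncertainty_anti x hKS).trans
          (I.uncertainty_dependsOn K fun i hi => mem_cell.1 hx i hi).le
      have h4 : (2 : ℝ) ^ t * I.uncertainty S' x ≤ I.uncertainty K y := by
        exact_mod_cast h2.trans h3
      have h5 : D * m ≤ 2 ^ t * I.uncertainty S' x :=
        mul_le_mul ht hlive hm.le (by positivity)
      linarith
  have h2 : 0 ≤ ∑ x ∈ cell K y with B < T.totalCost I.cost x, I.weight x :=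
    Finset.sum_nonneg fun x _ => hp x
  have h3 : 0 ≤ ∑ x ∈ cell K y with m ≤ (I.uncertainty S x : ℝ), I.weight x :=
    Finset.sum_nonneg fun x _ => hp x
  linarith

end CoverInstance

namespace CoverInstance

variable {ι U : Type*} [Fintype ι] [DecidableEq ι] [Fintype U] [DecidableEq U]

/-- The increase of `f` that the elements of `A` cause in the presence of `X`. -/
def marginal (I : CoverInstance ι U) (X A : Finset U) : ℝ := I.f (X ∪ A) - I.f X

theorem marginal_nonneg (I : CoverInstance ι U) (X A : Finset U) : 0 ≤ I.marginal X A := by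
  have : I.f X ≤ I.f (X ∪ A) := I.mono Finset.subset_union_left
  rw [marginal, sub_nonneg]
  exact_mod_cast this

theorem marginal_anti (I : CoverInstance ι U) {X Y : Finset U} (h : X ⊆ Y) (A : Finset U) :
    I.marginal Y A ≤ I.marginal X A := by
  have h1 := I.submodular (X ∪ A) Y
  have h2 : X ∪ A ∪ Y = Y ∪ A := by
    rw [Finset.union_right_comm, Finset.union_eq_right.2 h]
  have h3 : I.f X ≤ I.f ((X ∪ A) ∩ Y) := I.mono (Finset.subset_inter Finset.subset_union_left h)
  rw [h2] at h1
  have h4 : I.f (Y ∪ A) + I.f X ≤ I.f (X ∪ A) + I.f Y := by omega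
  have h5 : (I.f (Y ∪ A) : ℝ) + I.f X ≤ I.f (X ∪ A) + I.f Y := by exact_mod_cast h4
  unfold marginal
  linarith

theorem marginal_union (I : CoverInstance ι U) (X A B : Finset U) :
    I.marginal X (A ∪ B) = I.marginal X A + I.marginal (X ∪ A) B := by
  simp only [marginal, Finset.union_assoc]
  ring

theorem marginal_image_le (I : CoverInstance ι U) (X : Finset U) (P : Finset ι) (x : ι → U) :
    I.marginal X (P.image x) ≤ ∑ e ∈ P, I.marginal X {x e} := by
  induction P using Finset.induction_on with
  | empty => simp [marginal]
  | insert e P he ih =>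
    rw [Finset.sum_insert he, Finset.image_insert, Finset.insert_eq, marginal_union]
    exact add_le_add le_rfl ((I.marginal_anti Finset.subset_union_left _).trans ih)

/-- If each set `A j` completes the set `S j` to a set of maximal value, then the average relative
gain of a random `A j'` over a random `S j` is at least of the order of `1 / D`. -/
theorem sq_sum_le_cross_gain (I : CoverInstance ι U) {J : Type*} (N : Finset J) {ν : J → ℝ}
    (hν : ∀ j, 0 ≤ ν j) (S A : J → Finset U) (Y : Finset U) {D m : ℝ} (hD : 0 < D) (hm : 0 < m)
    (hcover : ∀ j ∈ N, I.f (S j ∪ A j) = I.Q) (hY : ∀ j ∈ N, Y ⊆ S j)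
    (hS : ∀ j ∈ N, m ≤ (I.Q : ℝ) - I.f (S j)) (hYm : (I.Q : ℝ) - I.f Y ≤ D * m) :
    (∑ j ∈ N, ν j) ^ 2 ≤
      4 * D * ∑ j' ∈ N, ν j' * ∑ j ∈ N, ν j * (I.marginal (S j) (A j') / (I.Q - I.f (S j))) := by
  set W := ∑ j ∈ N, ν j with hW
  let H : Finset U → ℝ := fun X => ∑ j ∈ N, ν j * (I.marginal (S j) X / (I.Q - I.f (S j)))
  change W ^ 2 ≤ 4 * D * ∑ j' ∈ N, ν j' * H (A j')
  set G := ∑ j' ∈ N, ν j' * H (A j') with hG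
  have hres : ∀ j ∈ N, 0 < (I.Q : ℝ) - I.f (S j) := fun j hj => hm.trans_le (hS j hj)
  have hH0 : ∀ X, 0 ≤ H X := fun X => Finset.sum_nonneg fun j hj =>
    mul_nonneg (hν j) (div_nonneg (I.marginal_nonneg _ _) (hres j hj).le)
  have hG0 : 0 ≤ G := Finset.sum_nonneg fun j _ => mul_nonneg (hν j) (hH0 _)
  have hW0 : 0 ≤ W := Finset.sum_nonneg fun j _ => hν j
  rcases hW0.eq_or_lt with h0 | hWpos
  · rw [← h0]
    nlinarith [mul_nonneg hD.le hG0]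
  set lam := 2 * D * m / W with hlam
  have hlam0 : 0 < lam := by positivity
  obtain ⟨X, hX, hmax⟩ := Finset.exists_max_image ({X | Y ⊆ X} : Finset (Finset U))
    (fun X => (I.f X : ℝ) - lam * H X) ⟨Y, by simp⟩
  simp only [Finset.mem_filter, Finset.mem_univ, true_and] at hX hmax
  have hHY : H Y = 0 := Finset.sum_eq_zero fun j hj => by
    rw [marginal, Finset.union_eq_left.2 (hY j hj)]
    simp
  have h1 : lam * H X ≤ D * m := by
    have h2 := hmax Y subset_rfl
    rw [hHY] at h2
    have h3 : (I.f X : ℝ) ≤ I.Q := by exact_mod_cast I.mono (Finset.subset_univ X)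
    linarith
  have hsub : ∀ B, H (X ∪ B) ≤ H X + H B := by
    intro B
    simp only [H]
    rw [← Finset.sum_add_distrib]
    refine Finset.sum_le_sum fun j hj => ?_
    rw [← mul_add, ← add_div, marginal_union]
    refine mul_le_mul_of_nonneg_left (div_le_div_of_nonneg_right ?_ (hres j hj).le) (hν j)
    exact add_le_add le_rfl (I.marginal_anti Finset.subset_union_left _)
  have h2 : ∀ B, I.marginal X B ≤ lam * H B := by
    intro B
    have h3 := hmax (X ∪ B) (hX.trans Finset.subset_union_left)
    have h4 := mul_le_mul_of_nonneg_left (hsub B) hlam0.le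
    rw [marginal]
    linarith
  have h3 : W - lam / m * G ≤ H X := by
    rw [hW, hG, Finset.mul_sum, ← Finset.sum_sub_distrib]
    refine Finset.sum_le_sum fun j hj => ?_
    have h4 : (I.Q : ℝ) - I.f (S j) - lam * H (A j) ≤ I.marginal (S j) X := by
      have h5 : I.marginal (S j) (A j) = I.Q - I.f (S j) := by rw [marginal, hcover j hj]
      have h6 : I.marginal (S j) (A j) ≤ I.marginal (S j) (X ∪ A j) := by
        rw [Finset.union_comm, marginal_union]
        linarith [I.marginal_nonneg (S j ∪ A j) X]
      have h7 := I.marginal_anti (Finset.subset_union_right (s₁ := S j) (s₂ := X)) (A j)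
      rw [marginal_union] at h6
      linarith [h2 (A j)]
    have h5 : 1 - lam / m * H (A j) ≤ I.marginal (S j) X / (I.Q - I.f (S j)) := by
      rw [le_div_iff₀ (hres j hj)]
      refine le_trans ?_ h4
      have h6 : lam * H (A j) ≤ lam / m * H (A j) * (I.Q - I.f (S j)) := by
        have h7 : 0 ≤ lam / m * H (A j) := mul_nonneg (by positivity) (hH0 _)
        have h8 := mul_le_mul_of_nonneg_left (hS j hj) h7
        have h9 : lam / m * H (A j) * m = lam * H (A j) := by field_simp
        linarith
      linarith
    have := mul_le_mul_of_nonneg_left h5 (hν j)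
    linarith
  have h4 := (mul_le_mul_of_nonneg_left h3 hlam0.le).trans h1
  have h5 : lam * (W - lam / m * G) = D * m * (2 - 4 * D * G / W ^ 2) := by
    rw [hlam]
    field_simp
    ring
  rw [h5] at h4
  have h6 : 2 - 4 * D * G / W ^ 2 ≤ 1 :=
    le_of_mul_le_mul_left (by linarith) (by positivity : 0 < D * m)
  have h7 : 1 ≤ 4 * D * G / W ^ 2 := by linarith
  rwa [le_div_iff₀ (by positivity), one_mul] at h7

/-- In a product distribution, one coordinate can be resampled. -/
theorem sum_resample {p : (ι → U) → ℝ} {q : ι → U → ℝ} (hp : ∀ x, p x = ∏ i, q i (x i)) (e : ι)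
    (hq : ∑ u, q e u = 1) {Φ : (ι → U) → U → ℝ}
    (hΦ : ∀ x v u, Φ (Function.update x e v) u = Φ x u) :
    ∑ x, p x * Φ x (x e) = ∑ x, p x * ∑ u, q e u * Φ x u := by
  have hswap : ∀ (x : ι → U) (u : U), p (Function.update x e u) * q e (x e) = p x * q e u := by
    intro x u
    rw [hp, hp, Fintype.prod_eq_mul_prod_compl e, Fintype.prod_eq_mul_prod_compl e,
      Function.update_self]
    have : ∏ i ∈ {e}ᶜ, q i (Function.update x e u i) = ∏ i ∈ {e}ᶜ, q i (x i) :=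
      Finset.prod_congr rfl fun i hi => by
        rw [Function.update_of_ne (by simpa using hi)]
    rw [this]
    ring
  calc ∑ x, p x * Φ x (x e) = ∑ z : (ι → U) × U, p z.1 * q e z.2 * Φ z.1 (z.1 e) := by
        rw [Fintype.sum_prod_type]
        refine Finset.sum_congr rfl fun x _ => ?_
        dsimp only
        rw [← Finset.sum_mul, ← Finset.mul_sum, hq, mul_one]
    _ = ∑ z : (ι → U) × U, p z.1 * q e z.2 * Φ z.1 z.2 := by
        refine Finset.sum_nbij' (fun z => (Function.update z.1 e z.2, z.1 e))
          (fun z => (Function.update z.1 e z.2, z.1 e)) (by simp) (by simp) (by simp) (by simp) ?_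
        rintro ⟨x, u⟩ -
        simp only [hΦ, hswap]
    _ = ∑ x, p x * ∑ u, q e u * Φ x u := by
        rw [Fintype.sum_prod_type]
        refine Finset.sum_congr rfl fun x _ => ?_
        rw [Finset.mul_sum]
        exact Finset.sum_congr rfl fun u _ => by ring

/-- The part of the maximal value that is not yet attained when the items in `S` are known. -/
def residual (I : CoverInstance ι U) (S : Finset ι) (x : ι → U) : ℕ := I.Q - I.f (S.image x)

theorem cast_residual (I : CoverInstance ι U) (S : Finset ι) (x : ι → U) :
    (I.residual S x : ℝ) = I.Q - I.f (S.image x) :=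
  Nat.cast_sub (I.mono (Finset.subset_univ _))

theorem residual_anti (I : CoverInstance ι U) {S T : Finset ι} (x : ι → U) (h : S ⊆ T) :
    I.residual T x ≤ I.residual S x :=
  Nat.sub_le_sub_left (I.mono (Finset.image_subset_image h)) _

theorem residual_dependsOn (I : CoverInstance ι U) (K : Finset ι) :
    DependsOn (I.residual K) (K : Set ι) := by
  intro x y h
  rw [residual, residual, image_congr h]

/-- The expected relative gain of the item `e` over the outcomes in `N`, where `S` is known. -/
noncomputable def relativeGain (I : CoverInstance ι U) (N : Finset (ι → U)) (S : Finset ι) (e : ι) :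
    ℝ :=
  ∑ x ∈ N, I.weight x * (I.marginal (S.image x) {x e} / I.residual S x)

end CoverInstance

namespace CoverInstance

variable {ι U : Type*} [Fintype ι] [DecidableEq ι] [Fintype U] [DecidableEq U]

/-- The outcomes in the cell of `K` for which the items in `S` leave a residual of at least `m`. -/
noncomputable def liveSet (I : CoverInstance ι U) (K : Finset ι) (y : ι → U) (m : ℝ)
    (S : Finset ι) : Finset (ι → U) :=
  {x ∈ cell K y | m ≤ (I.residual S x : ℝ)}

theorem update_mem_liveSet (I : CoverInstance ι U) {K S : Finset ι} (hKS : K ⊆ S) {y : ι → U}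
    {m : ℝ} {e : ι} (he : e ∉ S) (x : ι → U) (v : U) :
    Function.update x e v ∈ I.liveSet K y m S ↔ x ∈ I.liveSet K y m S := by
  have h : ∀ i ∈ (S : Set ι), Function.update x e v i = x i := fun i hi =>
    Function.update_of_ne (ne_of_mem_of_not_mem (Finset.mem_coe.1 hi) he) _ _
  have h1 : Function.update x e v ∈ cell K y ↔ x ∈ cell K y := by
    simp only [mem_cell]
    exact forall₂_congr fun i hi => by rw [h i (hKS hi)]
  rw [liveSet, Finset.mem_filter, Finset.mem_filter, h1, I.residual_dependsOn S h]

/-- The reaction of the policy to one outcome is independent of the gain under another one. -/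
theorem sum_cross_gain_eq (I : CoverInstance ι U) {q : ι → U → ℝ}
    (hp : ∀ x, I.weight x = ∏ i, q i (x i)) (hq : ∀ e, ∑ u, q e u = 1)
    {K S : Finset ι} (hKS : K ⊆ S) (y : ι → U) (m B : ℝ) (T : AdaptivePolicy ι U)
    {e : ι} (he : e ∉ S) :
    ∑ x' ∈ I.liveSet K y m S with e ∈ T.probedWithin I.cost B x', I.weight x' *
      ∑ x ∈ I.liveSet K y m S, I.weight x * (I.marginal (S.image x) {x' e} / I.residual S x) =
    (∑ x' ∈ I.liveSet K y m S with e ∈ T.probedWithin I.cost B x', I.weight x') *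
      I.relativeGain (I.liveSet K y m S) S e := by
  set N := I.liveSet K y m S with hN
  have hupd := fun x v => I.update_mem_liveSet hKS (y := y) (m := m) he x v
  have hS : ∀ (x : ι → U) (v : U), ∀ i ∈ (S : Set ι), Function.update x e v i = x i :=
    fun x v i hi => Function.update_of_ne (ne_of_mem_of_not_mem (Finset.mem_coe.1 hi) he) _ _
  let h : (ι → U) → U → ℝ := fun x u => I.marginal (S.image x) {u} / I.residual S x
  have hh : ∀ x v u, h (Function.update x e v) u = h x u := by
    intro x v u
    simp only [h]
    rw [image_congr (hS x v), I.residual_dependsOn S (hS x v)]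
  let Φ : U → ℝ := fun u => ∑ x ∈ N, I.weight x * h x u
  have hgain : I.relativeGain N S e = ∑ u, q e u * Φ u := by
    have h1 := sum_resample hp e (hq e) (Φ := fun x u => if x ∈ N then h x u else 0)
      (fun x v u => by simp only [hupd, hh, hN])
    calc I.relativeGain N S e = ∑ x, I.weight x * (if x ∈ N then h x (x e) else 0) := by
          simp only [mul_ite, mul_zero]
          rw [← Finset.sum_filter, Finset.filter_univ_mem]
          rfl
      _ = _ := h1
      _ = ∑ x ∈ N, I.weight x * ∑ u, q e u * h x u := by
          rw [← Finset.sum_filter_add_sum_filter_not Finset.univ (· ∈ N), Finset.filter_univ_mem]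
          rw [Finset.sum_eq_zero (s := ({x | x ∉ N} : Finset (ι → U))) (fun x hx => by
            simp [(Finset.mem_filter.1 hx).2]), add_zero]
          exact Finset.sum_congr rfl fun x hx => by simp [hx]
      _ = _ := by
          simp only [Φ, Finset.mul_sum]
          rw [Finset.sum_comm]
          exact Finset.sum_congr rfl fun u _ => Finset.sum_congr rfl fun x _ => by ring
  have h2 := sum_resample hp e (hq e)
    (Φ := fun x u => if x ∈ N ∧ e ∈ T.probedWithin I.cost B x then Φ u else 0)
    (fun x v u => by simp only [hN, hupd, AdaptivePolicy.mem_probedWithin_update])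
  have hfilter : ∀ F : (ι → U) → ℝ, ∑ x ∈ N with e ∈ T.probedWithin I.cost B x, F x =
      ∑ x, if x ∈ N ∧ e ∈ T.probedWithin I.cost B x then F x else 0 := by
    intro F
    rw [← Finset.sum_filter]
    congr 1
    ext x
    simp
  rw [hgain, hfilter, hfilter, Finset.sum_mul]
  calc _ = ∑ x, I.weight x * (if x ∈ N ∧ e ∈ T.probedWithin I.cost B x then Φ (x e) else 0) :=
        Finset.sum_congr rfl fun x _ => by
          rw [mul_ite, mul_zero]
    _ = _ := h2
    _ = _ := Finset.sum_congr rfl fun x _ => by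
        split_ifs
        · rfl
        · simp

/-- As long as the residual is large with a sufficient probability, some item has a large expected
relative gain, compared with its cost. -/
theorem exists_item (I : CoverInstance ι U) {q : ι → U → ℝ}
    (hp : ∀ x, I.weight x = ∏ i, q i (x i)) (hq : ∀ e, ∑ u, q e u = 1)
    {T : AdaptivePolicy ι U} (hT : I.AlwaysCovers T)
    {K S : Finset ι} (hKS : K ⊆ S) (y : ι → U) {D m B : ℝ} (hD : 0 < D) (hm : 0 < m) (hB : 0 ≤ B)
    (hR : (I.residual K y : ℝ) ≤ D * m)
    (hlive : 2 * (∑ x ∈ cell K y with B < T.totalCost I.cost x, I.weight x) <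
      ∑ x ∈ I.liveSet K y m S, I.weight x) :
    ∃ e ∉ S, (∑ x ∈ I.liveSet K y m S, I.weight x) / (16 * D) * I.cost e ≤
      B * I.relativeGain (I.liveSet K y m S) S e := by
  set N := I.liveSet K y m S with hN
  set u := ∑ x ∈ N, I.weight x with hu
  have hw := I.weight_nonneg
  have hustar : 0 ≤ ∑ x ∈ cell K y with B < T.totalCost I.cost x, I.weight x :=
    Finset.sum_nonneg fun x _ => hw x
  have hupos : 0 < u := by linarith
  let P : (ι → U) → Finset ι := fun x => T.probedWithin I.cost B x
  let π : ι → ℝ := fun e => ∑ x ∈ N with e ∈ P x, I.weight x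
  have hπ0 : ∀ e, 0 ≤ π e := fun e => Finset.sum_nonneg fun x _ => hw x
  set N' : Finset (ι → U) := {x ∈ N | T.totalCost I.cost x ≤ B ∧ I.weight x ≠ 0} with hN'
  have hN'N : N' ⊆ N := Finset.filter_subset _ _
  have hsmall : u / 2 ≤ ∑ x ∈ N', I.weight x := by
    have h1 : u ≤ ∑ x ∈ N', I.weight x +
        ∑ x ∈ cell K y with B < T.totalCost I.cost x, I.weight x := by
      have hdec := Finset.sum_filter_add_sum_filter_not N
        (fun x => T.totalCost I.cost x ≤ B ∧ I.weight x ≠ 0) I.weight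
      rw [← hN', ← hu] at hdec
      rw [← hdec]
      refine add_le_add le_rfl ?_
      rw [Finset.sum_filter, Finset.sum_filter]
      refine le_trans (Finset.sum_le_sum (g := fun x =>
        if B < T.totalCost I.cost x then I.weight x else 0) fun x _ => ?_)
        (Finset.sum_le_sum_of_subset_of_nonneg (Finset.filter_subset _ _) fun x _ _ => ?_)
      · by_cases h1 : T.totalCost I.cost x ≤ B
        · rw [if_neg (not_lt.2 h1)]
          by_cases h2 : I.weight x = 0
          · simp [h2]
          · rw [if_neg (not_not.2 ⟨h1, h2⟩)]
        · rw [if_pos (not_le.1 h1)]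
          rw [if_pos fun h2 => h1 h2.1]
      · split_ifs <;> simp [hw x]
    linarith
  have hcross := I.sq_sum_le_cross_gain N' hw (fun x => S.image x)
    (fun x => (P x \ S).image x) (K.image y) hD hm
    (fun x hx => by
      obtain ⟨-, h1, h2⟩ := Finset.mem_filter.1 hx
      rw [← Finset.image_union, Finset.union_sdiff_self_eq_union]
      refine I.isCovered_mono Finset.subset_union_right ?_
      simp only [P]
      rw [AdaptivePolicy.probedWithin_eq_probed I.cost_nonneg T x B h1]
      exact hT x ((I.weight_ne_zero_iff x).1 h2))
    (fun x hx => by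
      have h1 := mem_cell.1 (Finset.mem_filter.1 (hN'N hx)).1
      rw [← image_congr h1]
      exact Finset.image_subset_image hKS)
    (fun x hx => by
      rw [← cast_residual]
      exact (Finset.mem_filter.1 (hN'N hx)).2)
    (by rwa [← cast_residual])
  have hratio : ∀ x A, 0 ≤ I.weight x * (I.marginal (S.image x) A / I.residual S x) :=
    fun x A => mul_nonneg (hw x) (div_nonneg (I.marginal_nonneg _ _) (Nat.cast_nonneg _))
  have hdecouple : ∑ x' ∈ N', I.weight x' * ∑ x ∈ N', I.weight x *
      (I.marginal (S.image x) ((P x' \ S).image x') / (I.Q - I.f (S.image x))) ≤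
      ∑ e ∈ Sᶜ, π e * I.relativeGain N S e := by
    calc _ ≤ ∑ x' ∈ N, I.weight x' * ∑ x ∈ N, I.weight x *
          (I.marginal (S.image x) ((P x' \ S).image x') / I.residual S x) := by
          simp only [← cast_residual]
          refine (Finset.sum_le_sum fun x' _ => mul_le_mul_of_nonneg_left
            (Finset.sum_le_sum_of_subset_of_nonneg hN'N fun x _ _ => hratio x _) (hw x')).trans
            (Finset.sum_le_sum_of_subset_of_nonneg hN'N fun x' _ _ => ?_)
          exact mul_nonneg (hw x') (Finset.sum_nonneg fun x _ => hratio x _)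
      _ ≤ ∑ x' ∈ N, I.weight x' * ∑ x ∈ N, ∑ e ∈ P x' \ S, I.weight x *
          (I.marginal (S.image x) {x' e} / I.residual S x) := by
          refine Finset.sum_le_sum fun x' _ => mul_le_mul_of_nonneg_left
            (Finset.sum_le_sum fun x _ => ?_) (hw x')
          rw [← Finset.mul_sum, ← Finset.sum_div]
          exact mul_le_mul_of_nonneg_left (div_le_div_of_nonneg_right
            (I.marginal_image_le _ _ _) (Nat.cast_nonneg _)) (hw x)
      _ = ∑ e ∈ Sᶜ, ∑ x' ∈ N with e ∈ P x', I.weight x' *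
          ∑ x ∈ N, I.weight x * (I.marginal (S.image x) {x' e} / I.residual S x) := by
          simp only [Finset.sum_filter]
          rw [Finset.sum_comm]
          refine Finset.sum_congr rfl fun x' _ => ?_
          rw [Finset.sum_comm, ← Finset.sum_filter, Finset.mul_sum]
          refine Finset.sum_congr ?_ fun e _ => rfl
          ext e
          simp [and_comm]
      _ = ∑ e ∈ Sᶜ, π e * I.relativeGain N S e := by
          refine Finset.sum_congr rfl fun e he => ?_
          exact I.sum_cross_gain_eq hp hq hKS y m B T (Finset.mem_compl.1 he)
  have hgain : u ^ 2 ≤ 16 * D * ∑ e ∈ Sᶜ, π e * I.relativeGain N S e := by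
    have h1 := hcross.trans (mul_le_mul_of_nonneg_left hdecouple (by positivity))
    have h2 : (u / 2) ^ 2 ≤ (∑ x ∈ N', I.weight x) ^ 2 :=
      pow_le_pow_left₀ (by positivity) hsmall 2
    linarith
  have hcost : ∑ e ∈ Sᶜ, π e * I.cost e ≤ u * B := by
    calc ∑ e ∈ Sᶜ, π e * I.cost e
        ≤ ∑ e, π e * I.cost e := Finset.sum_le_sum_of_subset_of_nonneg (Finset.subset_univ _)
          fun e _ _ => mul_nonneg (hπ0 e) (I.cost_nonneg e)
      _ = ∑ x ∈ N, I.weight x * ∑ e ∈ P x, I.cost e := by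
          simp only [π, Finset.sum_filter, Finset.sum_mul]
          rw [Finset.sum_comm]
          refine Finset.sum_congr rfl fun x _ => ?_
          simp only [ite_mul, zero_mul]
          rw [← Finset.sum_filter, Finset.filter_univ_mem, Finset.mul_sum]
      _ ≤ ∑ x ∈ N, I.weight x * B := Finset.sum_le_sum fun x _ =>
          mul_le_mul_of_nonneg_left
            (AdaptivePolicy.sum_probedWithin_le I.cost_nonneg T x B hB) (hw x)
      _ = u * B := by rw [hu, Finset.sum_mul]
  by_contra! hcon
  have hstrict : ∑ e ∈ Sᶜ, π e * (B * I.relativeGain N S e) <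
      ∑ e ∈ Sᶜ, π e * (u / (16 * D) * I.cost e) := by
    refine Finset.sum_lt_sum (fun e he => mul_le_mul_of_nonneg_left
      (hcon e (Finset.mem_compl.1 he)).le (hπ0 e)) ?_
    by_contra! hzero
    have hπz : ∀ e ∈ Sᶜ, π e = 0 := fun e he => by
      by_contra hne
      have h1 : 0 < π e := lt_of_le_of_ne (hπ0 e) (Ne.symm hne)
      exact absurd (hzero e he)
        (not_le.2 (mul_lt_mul_of_pos_left (hcon e (Finset.mem_compl.1 he)) h1))
    rw [Finset.sum_eq_zero fun e he => by rw [hπz e he, zero_mul], mul_zero] at hgain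
    nlinarith
  have h1 : ∑ e ∈ Sᶜ, π e * (B * I.relativeGain N S e) =
      B * ∑ e ∈ Sᶜ, π e * I.relativeGain N S e := by
    rw [Finset.mul_sum]
    exact Finset.sum_congr rfl fun e _ => by ring
  have h2 : ∑ e ∈ Sᶜ, π e * (u / (16 * D) * I.cost e) =
      u / (16 * D) * ∑ e ∈ Sᶜ, π e * I.cost e := by
    rw [Finset.mul_sum]
    exact Finset.sum_congr rfl fun e _ => by ring
  rw [h1, h2] at hstrict
  have h3 : u / (16 * D) * ∑ e ∈ Sᶜ, π e * I.cost e ≤ u / (16 * D) * (u * B) :=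
    mul_le_mul_of_nonneg_left hcost (by positivity)
  have h4 : u / (16 * D) * (u * B) = B * (u ^ 2 / (16 * D)) := by ring
  have h5 : u ^ 2 / (16 * D) ≤ ∑ e ∈ Sᶜ, π e * I.relativeGain N S e := by
    rw [div_le_iff₀ (by positivity)]
    linarith
  have h6 := mul_le_mul_of_nonneg_left h5 hB
  linarith

/-- The logarithmic potential of a residual `t`, relative to the threshold `m`. -/
noncomputable def potential (D m : ℝ) (t : ℕ) : ℝ :=
  if m ≤ t then Real.log (D * m / t) else 1 + Real.log D

theorem potential_nonneg {D m : ℝ} (hD : 1 ≤ D) {t : ℕ} (hm : 0 < m) (ht : (t : ℝ) ≤ D * m) :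
    0 ≤ potential D m t := by
  unfold potential
  split_ifs with h
  · exact Real.log_nonneg ((one_le_div (hm.trans_le h)).2 ht)
  · linarith [Real.log_nonneg hD]

theorem potential_le {D m : ℝ} (hD : 1 ≤ D) (hm : 0 < m) (t : ℕ) :
    potential D m t ≤ 1 + Real.log D := by
  unfold potential
  split_ifs with h
  · have ht : (0 : ℝ) < t := hm.trans_le h
    have : Real.log (D * m / t) ≤ Real.log D := by
      refine Real.log_le_log (by positivity) ?_
      rw [div_le_iff₀ ht]
      exact mul_le_mul_of_nonneg_left h (by linarith)
    linarith
  · exact le_rfl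

theorem potential_increase {D m : ℝ} (hD : 1 ≤ D) (hm : 0 < m) {s t : ℕ}
    (ht : m ≤ t) : ((t : ℝ) - s) / t ≤ potential D m s - potential D m t := by
  have htpos : (0 : ℝ) < t := hm.trans_le ht
  have hs0 : (0 : ℝ) ≤ s := Nat.cast_nonneg _
  have h1 : ((t : ℝ) - s) / t = 1 - s / t := by field_simp
  rw [h1, potential, potential, if_pos ht]
  split_ifs with hs
  · have hspos : (0 : ℝ) < s := hm.trans_le hs
    have h2 : Real.log (D * m / s) - Real.log (D * m / t) = Real.log (t / s) := by
      rw [← Real.log_div (by positivity) (by positivity)]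
      congr 1
      field_simp
    rw [h2]
    have h3 := Real.one_sub_inv_le_log_of_pos (div_pos htpos hspos)
    rwa [inv_div] at h3
  · have h2 : Real.log (D * m / t) ≤ Real.log D := by
      refine Real.log_le_log (by positivity) ?_
      rw [div_le_iff₀ htpos]
      exact mul_le_mul_of_nonneg_left ht (by linarith)
    have h3 : 0 ≤ (s : ℝ) / t := by positivity
    linarith

theorem isReducible_residual (I : CoverInstance ι U) {q : ι → U → ℝ}
    (hp : ∀ x, I.weight x = ∏ i, q i (x i)) (hq : ∀ e, ∑ u, q e u = 1)
    {T : AdaptivePolicy ι U} (hT : I.AlwaysCovers T) {D : ℝ} (hD : 1 ≤ D) :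
    IsReducible I.cost I.weight (T.totalCost I.cost) I.residual D
      (512 * (D * (1 + Real.log D))) := by
  refine ⟨I.residual_anti, I.residual_dependsOn, ?_⟩
  intro K y m hm hR S₀ hKS B hB
  have hw := I.weight_nonneg
  have hlog : 0 ≤ Real.log D := Real.log_nonneg hD
  change ∃ S', S₀ ⊆ S' ∧ _ ∧ ∑ x ∈ I.liveSet K y m S', I.weight x ≤
    _ + (∑ x ∈ I.liveSet K y m S₀, I.weight x) / 32
  set u₀ := ∑ x ∈ I.liveSet K y m S₀, I.weight x with hu₀
  set v := ∑ x ∈ cell K y with B < T.totalCost I.cost x, I.weight x with hv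
  have hv0 : 0 ≤ v := Finset.sum_nonneg fun x _ => hw x
  have hu0 : 0 ≤ u₀ := Finset.sum_nonneg fun x _ => hw x
  rcases hu0.eq_or_lt with h0 | hupos
  · refine ⟨S₀, subset_rfl, ?_, ?_⟩
    · simp only [sdiff_self, Finset.bot_eq_empty, Finset.sum_empty]
      positivity
    · rw [← hu₀, ← h0]
      linarith
  let ψ : Finset ι → ℝ := fun S => ∑ x ∈ cell K y, I.weight x * potential D m (I.residual S x)
  have hRcell : ∀ x ∈ cell K y, ∀ S, K ⊆ S → (I.residual S x : ℝ) ≤ D * m := by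
    intro x hx S hS
    have h1 : I.residual K x = I.residual K y :=
      I.residual_dependsOn K fun i hi => mem_cell.1 hx i hi
    have h2 : (I.residual S x : ℝ) ≤ I.residual K x := by exact_mod_cast I.residual_anti x hS
    rw [h1] at h2
    exact h2.trans hR.le
  have hψ : ∀ S, S₀ ⊆ S → ψ S - ψ S₀ ≤ u₀ * (1 + Real.log D) := by
    intro S hS
    rw [hu₀, liveSet, Finset.sum_filter, Finset.sum_mul, ← Finset.sum_sub_distrib]
    refine Finset.sum_le_sum fun x hx => ?_
    rw [← mul_sub, ite_mul, zero_mul]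
    split_ifs with h1
    · refine mul_le_mul_of_nonneg_left ?_ (hw x)
      linarith [potential_le hD hm (I.residual S x),
        potential_nonneg hD hm (hRcell x hx S₀ hKS)]
    · have h2 : ¬ m ≤ (I.residual S x : ℝ) := fun h3 =>
        h1 (h3.trans (by exact_mod_cast I.residual_anti x hS))
      rw [potential, potential, if_neg h1, if_neg h2, sub_self, mul_zero]
  have hstep : ∀ S e, I.relativeGain (I.liveSet K y m S) S e ≤ ψ (insert e S) - ψ S := by
    intro S e
    rw [relativeGain, liveSet, Finset.sum_filter, ← Finset.sum_sub_distrib]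
    refine Finset.sum_le_sum fun x hx => ?_
    have hanti := I.residual_anti x (Finset.subset_insert e S)
    rw [← mul_sub]
    split_ifs with h1
    · refine mul_le_mul_of_nonneg_left ?_ (hw x)
      refine le_of_eq_of_le ?_ (potential_increase hD hm h1)
      rw [cast_residual, cast_residual, marginal, Finset.image_insert, Finset.union_comm,
        ← Finset.insert_eq]
      ring
    · have h2 : ¬ m ≤ (I.residual (insert e S) x : ℝ) := fun h3 =>
        h1 (h3.trans (by exact_mod_cast hanti))
      rw [potential, potential, if_neg h1, if_neg h2, sub_self, mul_zero]
  classical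
  obtain ⟨S, hS, hmax⟩ := Finset.exists_max_image
    ({S | S₀ ⊆ S ∧ u₀ / (512 * D) * ∑ e ∈ S \ S₀, I.cost e ≤ B * (ψ S - ψ S₀)} :
      Finset (Finset ι)) Finset.card ⟨S₀, by simp⟩
  simp only [Finset.mem_filter, Finset.mem_univ, true_and] at hS hmax
  obtain ⟨hS₀S, hcost⟩ := hS
  refine ⟨S, hS₀S, ?_, ?_⟩
  · have h1 := hcost.trans (mul_le_mul_of_nonneg_left (hψ S hS₀S) hB)
    have h2 : B * (u₀ * (1 + Real.log D)) =
        u₀ / (512 * D) * (512 * (D * (1 + Real.log D)) * B) := by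
      field_simp
    rw [h2] at h1
    exact le_of_mul_le_mul_left h1 (by positivity)
  · by_contra! hcon
    obtain ⟨e, he, hgain⟩ := I.exists_item hp hq hT (hKS.trans hS₀S) y (by linarith) hm hB hR.le
      (by linarith : 2 * v < ∑ x ∈ I.liveSet K y m S, I.weight x)
    have h1 : u₀ / (512 * D) * I.cost e ≤
        (∑ x ∈ I.liveSet K y m S, I.weight x) / (16 * D) * I.cost e := by
      refine mul_le_mul_of_nonneg_right ?_ (I.cost_nonneg e)
      rw [div_le_div_iff₀ (by positivity) (by positivity)]
      nlinarith
    have h2 := mul_le_mul_of_nonneg_left (hstep S e) hB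
    have h3 : insert e S \ S₀ = insert e (S \ S₀) :=
      Finset.insert_sdiff_of_notMem _ fun h => he (hS₀S h)
    have h4 : e ∉ S \ S₀ := fun h => he (Finset.mem_sdiff.1 h).1
    have h5 := hmax (insert e S) ⟨hS₀S.trans (Finset.subset_insert _ _), by
      rw [h3, Finset.sum_insert h4]
      linarith⟩
    rw [Finset.card_insert_of_notMem he] at h5
    omega

end CoverInstance

theorem IsReducible.mono {ι U : Type*} [Fintype ι] [DecidableEq ι] [Fintype U] [DecidableEq U]
    {c : ι → ℝ} {p τ : (ι → U) → ℝ} {R : Finset ι → (ι → U) → ℕ} {D α α' : ℝ}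
    (h : IsReducible c p τ R D α) (hα : α ≤ α') : IsReducible c p τ R D α' := by
  refine ⟨h.anti, h.dependsOn, fun K y m hm hR S hKS B hB => ?_⟩
  obtain ⟨S', h1, h2, h3⟩ := h.exists_extension K y m hm hR S hKS B hB
  exact ⟨S', h1, h2.trans (mul_le_mul_of_nonneg_right hα hB), h3⟩

theorem SetPolicy.finite (ι U : Type*) [Finite ι] [Finite U] (k : ℕ) :
    Finite (SetPolicy ι U k) := by
  induction k with
  | zero =>
    refine Finite.of_surjective (fun _ : Unit => SetPolicy.done) fun P => ?_
    cases P
    exact ⟨(), rfl⟩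
  | succ k ih =>
    refine Finite.of_surjective
      (fun z : Σ S : Finset ι, ((S → U) → SetPolicy ι U k) => SetPolicy.round z.1 z.2) fun P => ?_
    cases P with
    | round S next => exact ⟨⟨S, next⟩, rfl⟩

/-- The number of levels, and the cost of one level, multiply to the logarithm of `M`. -/
theorem exists_levels {M r : ℕ} (hM : 1 ≤ M) (hr : 1 ≤ r) {L : ℝ} (hML : Real.log M ≤ L)
    (h2L : Real.log 2 ≤ L) :
    ∃ l ≤ r, (M : ℝ) < (2 * (M : ℝ) ^ (1 / (r : ℝ))) ^ l ∧
      l * (1 + Real.log (2 * (M : ℝ) ^ (1 / (r : ℝ)))) ≤ 8 * L := by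
  have hM' : (1 : ℝ) ≤ M := by exact_mod_cast hM
  have hr' : (1 : ℝ) ≤ r := by exact_mod_cast hr
  have hroot : (1 : ℝ) ≤ (M : ℝ) ^ (1 / (r : ℝ)) := Real.one_le_rpow hM' (by positivity)
  have hlogD : Real.log (2 * (M : ℝ) ^ (1 / (r : ℝ))) = Real.log 2 + Real.log M / r := by
    rw [Real.log_mul (by norm_num) (by positivity), Real.log_rpow (by linarith)]
    ring
  set D := 2 * (M : ℝ) ^ (1 / (r : ℝ)) with hD
  have hlogM : 0 ≤ Real.log M := Real.log_nonneg hM'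
  have hlogMr : Real.log M / r ≤ Real.log M := div_le_self hlogM hr'
  have hlogMr0 : 0 ≤ Real.log M / r := by positivity
  have hlog2 := Real.log_two_gt_d9
  have hpow : (M : ℝ) < D ^ r := by
    rw [hD, mul_pow, ← Real.rpow_natCast ((M : ℝ) ^ (1 / (r : ℝ))) r, ← Real.rpow_mul (by linarith),
      one_div_mul_cancel (by positivity), Real.rpow_one]
    have : (2 : ℝ) ≤ 2 ^ r := by
      simpa using pow_le_pow_right₀ (by norm_num : (1 : ℝ) ≤ 2) hr
    nlinarith
  have hex : ∃ l : ℕ, (M : ℝ) < D ^ l := ⟨r, hpow⟩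
  classical
  obtain ⟨l, hl, hmin⟩ : ∃ l : ℕ, (M : ℝ) < D ^ l ∧ ∀ k : ℕ, (M : ℝ) < D ^ k → l ≤ k :=
    ⟨Nat.find hex, Nat.find_spec hex, fun k hk => Nat.find_min' hex hk⟩
  refine ⟨l, hmin r hpow, hl, ?_⟩
  have h1 : ((l : ℝ) - 1) * Real.log D ≤ L := by
    rcases l.eq_zero_or_pos with h0 | hpos
    · rw [h0]
      push_cast
      linarith
    · have h2 : D ^ (l - 1) ≤ (M : ℝ) := by
        by_contra! h3
        have := hmin _ h3
        omega
      have h3 := Real.log_le_log (by positivity) h2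
      rw [Real.log_pow, Nat.cast_sub hpos, Nat.cast_one] at h3
      linarith
  have h2 : 1 + Real.log D ≤ 5 / 2 * Real.log D := by linarith
  have h3 := mul_le_mul_of_nonneg_left h2 (Nat.cast_nonneg l : (0 : ℝ) ≤ l)
  linarith

namespace CoverInstance

variable {ι U : Type*} [Fintype ι] [DecidableEq ι] [Fintype U] [DecidableEq U]

theorem sum_toReal_eq_one {α : Type*} [Fintype α] (p : PMF α) : ∑ a, (p a).toReal = 1 := by
  have h : ∑ a, p a = 1 := by rw [← p.tsum_coe, tsum_fintype]
  rw [← ENNReal.toReal_sum fun a _ => p.apply_ne_top a, h, ENNReal.toReal_one]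

theorem one_sub_le_coverProb (I : CoverInstance ι U) {k : ℕ} (P : SetPolicy ι U k)
    (F : Finset (ι → U))
    (hF : ∀ x, I.weight x ≠ 0 → x ∉ F → I.IsCovered (P.probed x) x) :
    1 - ∑ x ∈ F, I.weight x ≤ I.coverProb P := by
  classical
  have h1 : I.coverProb P = ∑ x, if I.IsCovered (P.probed x) x then I.weight x else 0 := by
    rw [coverProb, PMF.toOuterMeasure_apply_fintype, ENNReal.toReal_sum]
    · refine Finset.sum_congr rfl fun x _ => ?_
      rw [Set.indicator_apply]
      simp only [Set.mem_ofPred_eq]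
      split_ifs
      · rfl
      · exact ENNReal.toReal_zero
    · intro x _
      rw [Set.indicator_apply]
      split_ifs
      exacts [I.dist.apply_ne_top x, ENNReal.zero_ne_top]
  have h2 : ∑ x, I.weight x = 1 := sum_toReal_eq_one I.dist
  have h3 : ∑ x ∈ F, I.weight x = ∑ x, if x ∈ F then I.weight x else 0 := by
    rw [← Finset.sum_filter, Finset.filter_univ_mem]
  rw [h1, h3, sub_le_iff_le_add, ← h2, ← Finset.sum_add_distrib]
  refine Finset.sum_le_sum fun x _ => ?_
  have h0 := I.weight_nonneg x
  by_cases hx : I.weight x = 0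
  · simp [hx]
  by_cases hxF : x ∈ F
  · rw [if_pos hxF]
    split_ifs <;> linarith
  · rw [if_pos (hF x hx hxF), if_neg hxF, add_zero]

theorem OPT_nonneg (I : CoverInstance ι U) : 0 ≤ I.OPT := by
  refine Real.sInf_nonneg ?_
  rintro _ ⟨T, -, rfl⟩
  exact Finset.sum_nonneg fun x _ =>
    mul_nonneg (I.weight_nonneg x) (T.totalCost_nonneg I.cost_nonneg x)

theorem exists_alwaysCovers (I : CoverInstance ι U) :
    ∃ T : AdaptivePolicy ι U, I.AlwaysCovers T := by
  let T : List ι → AdaptivePolicy ι U := fun l => l.foldr (fun i t => .probe i fun _ => t) .halt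
  have hT : ∀ (l : List ι) (x : ι → U), ∀ i ∈ l, i ∈ (T l).probed x := by
    intro l x
    induction l with
    | nil => simp
    | cons j l ih =>
      intro i hi
      rcases List.mem_cons.1 hi with rfl | hi
      · exact Finset.mem_insert_self _ _
      · exact Finset.mem_insert_of_mem (ih i hi)
  refine ⟨T Finset.univ.toList, fun x hx => ?_⟩
  have h1 : (T Finset.univ.toList).probed x = Finset.univ :=
    Finset.eq_univ_iff_forall.2 fun i => hT _ x i (by simp)
  rw [IsCovered, h1]
  exact I.feasible x hx

/-- A bound on the cost relative to every covering policy is a bound relative to the optimum. -/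
theorem exists_le_OPT (I : CoverInstance ι U) {k : ℕ} {F δ : ℝ} (hF : 0 ≤ F)
    (h : ∀ T : AdaptivePolicy ι U, I.AlwaysCovers T → ∃ P : SetPolicy ι U k,
      I.setCost P ≤ F * I.expect (T.totalCost I.cost) ∧ δ ≤ I.coverProb P) :
    ∃ P : SetPolicy ι U k, I.setCost P ≤ F * I.OPT ∧ δ ≤ I.coverProb P := by
  have := SetPolicy.finite ι U k
  obtain ⟨T₀, hT₀⟩ := I.exists_alwaysCovers
  obtain ⟨P₀, -, hP₀⟩ := h T₀ hT₀
  obtain ⟨P, hP, hmin⟩ := Set.exists_min_image {P : SetPolicy ι U k | δ ≤ I.coverProb P} I.setCost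
    (Set.toFinite _) ⟨P₀, hP₀⟩
  refine ⟨P, le_of_forall_pos_le_add fun ε hε => ?_, hP⟩
  obtain ⟨_, ⟨T, hT, rfl⟩, hlt⟩ := Real.lt_sInf_add_pos
    (s := {a : ℝ | ∃ T : AdaptivePolicy ι U, I.AlwaysCovers T ∧ a = I.expect (T.totalCost I.cost)})
    ⟨_, T₀, hT₀, rfl⟩ (by positivity : 0 < ε / (F + 1))
  obtain ⟨P', hP', hP'2⟩ := h T hT
  calc I.setCost P ≤ I.setCost P' := hmin P' hP'2
    _ ≤ F * I.expect (T.totalCost I.cost) := hP'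
    _ ≤ F * (I.OPT + ε / (F + 1)) := mul_le_mul_of_nonneg_left hlt.le hF
    _ = F * I.OPT + F / (F + 1) * ε := by ring
    _ ≤ F * I.OPT + ε := by
      have : F / (F + 1) ≤ 1 := (div_le_one (by linarith)).2 (by linarith)
      nlinarith

/-- The main reduction: a reducible measure of progress gives a solution with few rounds. -/
theorem exists_setPolicy (I : CoverInstance ι U) {R : Finset ι → (ι → U) → ℕ} {M r n : ℕ}
    (hM : 1 ≤ M) (hr : 1 ≤ r) (hn : 2 * r ≤ n) {L : ℝ} (hML : Real.log M ≤ L)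
    (h2L : Real.log 2 ≤ L) (hRM : ∀ x, R ∅ x ≤ M)
    (hcover : ∀ S x, I.weight x ≠ 0 → R S x = 0 → I.IsCovered S x)
    (hred : ∀ (T : AdaptivePolicy ι U) (D : ℝ), I.AlwaysCovers T → 1 ≤ D →
      IsReducible I.cost I.weight (T.totalCost I.cost) R D (512 * (D * (1 + Real.log D)))) :
    ∃ P : SetPolicy ι U n, I.setCost P ≤ 720896 * ((M : ℝ) ^ (1 / (r : ℝ)) * L) * I.OPT ∧
      1 - Real.exp (-(Real.log (16 / 9) * r)) ≤ I.coverProb P := by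
  have hM' : (1 : ℝ) ≤ M := by exact_mod_cast hM
  have hroot : (1 : ℝ) ≤ (M : ℝ) ^ (1 / (r : ℝ)) := Real.one_le_rpow hM' (by positivity)
  have hL0 : 0 ≤ L := (Real.log_nonneg (by norm_num)).trans h2L
  obtain ⟨l, hlr, hl, hlog⟩ := exists_levels hM hr hML h2L
  set D := 2 * (M : ℝ) ^ (1 / (r : ℝ)) with hD
  have hD1 : 1 ≤ D := by linarith
  have hlogD : 0 ≤ Real.log D := Real.log_nonneg hD1
  refine I.exists_le_OPT (by positivity) fun T hT => ?_
  obtain ⟨P, hdep, hP⟩ := (hred T D hT hD1).exists_policy I.weight_nonneg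
    (T.totalCost_nonneg I.cost_nonneg) (by positivity) hD1 l n ∅
  obtain ⟨y, -⟩ := I.dist.support_nonempty
  obtain ⟨hcost, hfail⟩ := hP y (lt_of_le_of_lt (by exact_mod_cast hRM y) hl)
  have hconst : ∀ x, P x = P y := fun x =>
    hdep fun i hi => absurd (Finset.mem_coe.1 hi) (Finset.notMem_empty i)
  rw [cell_empty] at hcost hfail
  simp only [hconst, Finset.empty_union] at hcost hfail
  have hE : 0 ≤ ∑ x, I.weight x * T.totalCost I.cost x := Finset.sum_nonneg fun x _ =>
    mul_nonneg (I.weight_nonneg x) (T.totalCost_nonneg I.cost_nonneg x)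
  refine ⟨P y, ?_, ?_⟩
  · refine hcost.trans (mul_le_mul_of_nonneg_right ?_ hE)
    have h1 : 88 * (512 * (D * (1 + Real.log D))) * l =
        88 * 512 * D * (l * (1 + Real.log D)) := by ring
    rw [h1]
    refine (mul_le_mul_of_nonneg_left hlog (by positivity)).trans_eq ?_
    rw [hD]
    ring
  · refine le_trans ?_ (I.one_sub_le_coverProb (P y)
      ({x | R ((P y).probed x) x ≠ 0} : Finset (ι → U)) fun x hx hxF =>
        hcover _ x hx (by simpa using hxF))
    have hone : ∑ x, I.weight x = 1 := sum_toReal_eq_one I.dist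
    rw [hone, mul_one] at hfail
    have h1 : (4 : ℝ) ^ l * (3 / 8) ^ n ≤ 4 ^ r * (3 / 8) ^ (2 * r) :=
      mul_le_mul (pow_le_pow_right₀ (by norm_num) hlr)
        (pow_le_pow_of_le_one (by norm_num) (by norm_num) hn) (by positivity) (by positivity)
    have h2 : Real.exp (-(Real.log (16 / 9) * r)) = 4 ^ r * (3 / 8) ^ (2 * r) := by
      rw [← neg_mul, ← Real.log_inv, mul_comm, Real.exp_nat_mul, Real.exp_log (by norm_num),
        pow_mul, ← mul_pow]
      norm_num
    linarith

theorem isReducible_uncertainty_log (I : CoverInstance ι U) {T : AdaptivePolicy ι U}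
    (hT : I.AlwaysCovers T) {D : ℝ} (hD : 1 ≤ D) :
    IsReducible I.cost I.weight (T.totalCost I.cost) I.uncertainty D
      (512 * (D * (1 + Real.log D))) := by
  have hlog2 := Real.log_two_gt_d9
  have hlogD : 0 ≤ Real.log D := Real.log_nonneg hD
  set t := ⌈Real.log D / Real.log 2⌉₊ with ht
  have h1 : Real.log D / Real.log 2 ≤ t := Nat.le_ceil _
  have h2 : (t : ℝ) < Real.log D / Real.log 2 + 1 := Nat.ceil_lt_add_one (by positivity)
  have h3 : D ≤ 2 ^ t := by
    rw [div_le_iff₀ (by linarith), ← Real.log_pow] at h1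
    exact (Real.log_le_log_iff (by linarith) (by positivity)).1 h1
  refine (I.isReducible_uncertainty hT (by linarith) h3).mono ?_
  have h4 : Real.log D / Real.log 2 ≤ 2 * Real.log D := by
    rw [div_le_iff₀ (by linarith)]
    nlinarith
  have h5 : (t : ℝ) ≤ 512 * (1 + Real.log D) := by linarith
  nlinarith [mul_le_mul_of_nonneg_left h5 (by linarith : 0 ≤ D)]

theorem compatible_card_le (I : CoverInstance ι U) (S : Finset ι) (x : ι → U) :
    (I.compatible S x).card ≤ I.numScenarios := by
  rw [numScenarios, ← Set.ncard_coe_finset]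
  refine Set.ncard_le_ncard (fun z hz => ?_) (Set.toFinite _)
  exact (I.weight_ne_zero_iff z).1 (Finset.mem_filter.1 hz).2

theorem one_le_numScenarios (I : CoverInstance ι U) : 1 ≤ I.numScenarios :=
  (Set.ncard_pos (Set.toFinite _)).2 I.dist.support_nonempty

theorem isCovered_of_uncertainty_eq_zero (I : CoverInstance ι U) (S : Finset ι) (x : ι → U)
    (hx : I.weight x ≠ 0) (h : I.uncertainty S x = 0) : I.IsCovered S x := by
  by_contra hcov
  rw [uncertainty, if_neg hcov, Finset.card_eq_zero] at h
  have : x ∈ I.compatible S x := Finset.mem_filter.2 ⟨self_mem_cell S x, hx⟩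
  simp [h] at this

theorem isCovered_of_residual_eq_zero (I : CoverInstance ι U) (S : Finset ι) (x : ι → U)
    (h : I.residual S x = 0) : I.IsCovered S x :=
  le_antisymm (I.mono (Finset.subset_univ _)) (Nat.sub_eq_zero_iff_le.1 h)

/-- If `f` vanishes, it is covered without any probe. -/
theorem exists_setPolicy_of_Q_eq_zero (I : CoverInstance ι U) (hQ : I.Q = 0) (n : ℕ) {F δ : ℝ}
    (hF : 0 ≤ F) (hδ : 0 ≤ δ) :
    ∃ P : SetPolicy ι U n, I.setCost P ≤ F * I.OPT ∧ 1 - δ ≤ I.coverProb P := by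
  refine ⟨SetPolicy.idle n, ?_, ?_⟩
  · rw [setCost, expect]
    simp only [SetPolicy.totalCost_idle, mul_zero, Finset.sum_const_zero]
    exact mul_nonneg hF I.OPT_nonneg
  · have h := I.one_sub_le_coverProb (SetPolicy.idle n) ∅ fun x _ _ =>
      I.isCovered_of_residual_eq_zero _ x (by rw [residual, hQ, Nat.zero_sub])
    rw [Finset.sum_empty] at h
    linarith

end CoverInstance

end SubmodularCover

theorem mainTheorem8 :
    ∃ C c : ℝ, 0 < C ∧ 0 < c ∧
      ∀ (ι U : Type*) [Fintype ι] [DecidableEq ι] [Fintype U] [DecidableEq U]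
        (I : SubmodularCover.CoverInstance ι U) (r : ℕ), 1 ≤ r →
        (I.IsIndependent →
          ∃ P : SubmodularCover.SetPolicy ι U (2 * r),
            I.setCost P ≤
              C * ((I.Q : ℝ) ^ (1 / (r : ℝ)) * Real.log (max (I.Q : ℝ) 2)) * I.OPT ∧
            1 - Real.exp (-(c * r)) ≤ I.coverProb P) ∧
        (∃ P : SubmodularCover.SetPolicy ι U (4 * r),
            I.setCost P ≤
              C * ((I.numScenarios : ℝ) ^ (1 / (r : ℝ)) *
                Real.log (max ((I.numScenarios : ℝ) * (I.Q : ℝ)) 2)) * I.OPT ∧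
            1 - Real.exp (-(c * r)) ≤ I.coverProb P) := by
  refine ⟨720896, Real.log (16 / 9), by norm_num, Real.log_pos (by norm_num), ?_⟩
  intro ι U _ _ _ _ I r hr
  have hlog : ∀ a : ℝ, 0 ≤ Real.log (max a 2) := fun a =>
    Real.log_nonneg (by linarith [le_max_right a 2])
  have hlog2 : ∀ a : ℝ, Real.log 2 ≤ Real.log (max a 2) := fun a =>
    Real.log_le_log (by norm_num) (le_max_right a 2)
  rcases Nat.eq_zero_or_pos I.Q with hQ | hQ
  · refine ⟨fun _ => ?_, ?_⟩
    · exact I.exists_setPolicy_of_Q_eq_zero hQ _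
        (mul_nonneg (by norm_num) (mul_nonneg (by positivity) (hlog _))) (Real.exp_pos _).le
    · exact I.exists_setPolicy_of_Q_eq_zero hQ _
        (mul_nonneg (by norm_num) (mul_nonneg (by positivity) (hlog _))) (Real.exp_pos _).le
  refine ⟨fun hind => ?_, ?_⟩
  · obtain ⟨q, hq⟩ := hind
    have hp : ∀ x, I.weight x = ∏ i, (q i (x i)).toReal := fun x => by
      rw [SubmodularCover.CoverInstance.weight, hq x, ENNReal.toReal_prod]
    refine I.exists_setPolicy hQ hr le_rfl
      (Real.log_le_log (by exact_mod_cast hQ) (le_max_left _ _)) (hlog2 _)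
      (fun x => Nat.sub_le _ _) (fun S x _ h => I.isCovered_of_residual_eq_zero S x h)
      fun T D hT hD => I.isReducible_residual (q := fun i u => (q i u).toReal) hp
        (fun e => SubmodularCover.CoverInstance.sum_toReal_eq_one (q e)) hT hD
  · have hs := I.one_le_numScenarios
    refine I.exists_setPolicy hs hr (by omega) (Real.log_le_log (by exact_mod_cast hs) ?_)
      (hlog2 _) (fun x => ?_) I.isCovered_of_uncertainty_eq_zero
      fun T D hT hD => I.isReducible_uncertainty_log hT hD
    · refine le_trans ?_ (le_max_left _ _)
      exact le_mul_of_one_le_right (Nat.cast_nonneg _) (by exact_mod_cast hQ)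
    · rw [SubmodularCover.CoverInstance.uncertainty]
      split_ifs
      · exact Nat.zero_le _
      · exact I.compatible_card_le ∅ x
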